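/- **Setting (synthetic differential geometry).** Let $\mathcal E$ be the topos of sheaves on a site $(\mathcal C,J)$ and let $R$ be a commutative $\mathbb Q$-algebra object of $\mathcal E$ satisfying the general Kock–Lawvere axiom: for every Weil algebra $W$ over $\mathbb Q$ the canonical map $R\otimes W\to R^{\operatorname{Spec}_R(W)}$ is an isomorphism. All statements below are in the internal logic of $\mathcal E$. In $R^n$ write $x\sim y$ if $(y_i-x_i)(y_j-x_j)=0$ for all $i,j$. A subobject $U$ is *formally open* if $x\in U$ and $x\sim y$ imply $y\in U$. A *formal manifold* is an object $M$ of $\mathcal E$ covered by a family of charts, i.e. monomorphisms $V_i\hookrightarrow M$ with $V_i$ a formally open subobject of some $R^{n_i}$ and with formally open image; here $x\sim y$ in $M$ means that (locally) $x$ and $y$ have neighbouring coordinates in some chart. An *$n$-path* in $M$ is a sequence $x_0\sim x_1\sim\dots\sim x_n$; $M$ is *path connected* if any two points are joined by an $n$-path for some $n$. An *affine connection* on an object $M$ with a reflexive symmetric relation $\sim$ is a ternary operation $\lambda:(x,y,z)\mapsto[zxy]$, defined when $x\sim y$ and $x\sim z$, with $[zxy]\sim y$, $[zxy]\sim z$,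 $[zxx]=z$, $[xxy]=y$ and $[[zxy]yx]=z$. It is *symmetric* if $[zxy]=[yxz]$. It is *flat* if $[[axy]yz]=[axz]$ for all mutual neighbours $x,y,z$ and all $a\sim x$. It is *flat with respect to parallelograms* if $[[zxa]a[axb]]=[[zxb]b[bxa]]$ whenever $a,b,z\sim x$. The *grid* spanned by two paths $(x,y_1,\dots,y_n)$ and $(x,z_1,\dots,z_m)$ with common first point $x$ is given by $u_{0,0}=x$, $u_{0,j}=y_j$, $u_{i,0}=z_i$, $u_{i+1,j+1}=[u_{i+1,j}\,u_{i,j}\,u_{i,j+1}]$; its *codomain* is $u_{m,n}$. **Proposition.** Let $M$ be a path connected formal manifold, and let $\lambda$ be a symmetric flat affine connection on $M$ with respect to $\sim$. Then there is a unique everywhere defined affine connection $\Lambda$ on $M$ (an affine connection with respect to the relation for which any two points are neighbours) such that, for all $x,y,z$, the value $[zxy]$ of $\Lambda$ is the codomain of the $\lambda$-grid spanned by any path from $x$ to $y$ and any path from $x$ to $z$. This $\Lambda$ extends $\lambda$, is symmetric, and is flat with respect to (big) parallelograms, i.e. $[[zxa]a[axb]]=[[zxb]b[bxa]]$ in $\Lambda$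 for all $x,a,b,z\in M$. -/

import Mathlib

open CategoryTheory Opposite

universe v u w t s

/-!
Throughout, `(C, J)` is a site, and a sheaf on it is handled through its generalized elements
`x : M.obj (op c)` at the stages `c : C`; statements are those of the internal logic of the topos
of sheaves, unfolded: universal quantifiers range over all stages, and existential ones hold after
restriction along a covering sieve.
-/

namespace Kock

/-! ### The ring of scalars -/

section Scalars

variable {C : Type u} [Category.{v} C]

/-- The restriction of a vector `v ∈ Rⁿ` at stage `c` along `f : d ⟶ c`. -/
def resVec (R : Cᵒᵖ ⥤ CommAlgCat.{w} ℚ) {σ : Type} {c d : C} (f : d ⟶ c)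
    (v : σ → R.obj (op c)) : σ → R.obj (op d) :=
  fun k => (R.map f.op).hom (v k)

/-- The ideals `I` for which `ℚ[X_k : k ∈ σ] / I` (with `σ` finite) is a Weil algebra, presented
with the `X_k` in its maximal ideal: `I` lies in the ideal of the variables and contains
one of its powers. -/
def IsWeilIdeal {σ : Type} (I : Ideal (MvPolynomial σ ℚ)) : Prop :=
  I ≤ Ideal.span (Set.range MvPolynomial.X) ∧
    ∃ N : ℕ, (Ideal.span (Set.range MvPolynomial.X)) ^ N ≤ I

/-- `Spec_R(ℚ[X]/I)` at stage `c`: the common zeros of `I` in `R^σ`. -/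
def zeroLocus (R : Cᵒᵖ ⥤ CommAlgCat.{w} ℚ) {σ : Type} (I : Ideal (MvPolynomial σ ℚ)) (c : C) :
    Set (σ → R.obj (op c)) :=
  {x | ∀ p ∈ I, MvPolynomial.aeval x p = 0}

/-- The general Kock–Lawvere axiom for the ring object `R`: for each Weil algebra `W`, the
comparison map `R ⊗ W → R ^ Spec_R(W)` is bijective. An element of the exponential at stage `c`
is a natural family of functions at all later stages `d ⟶ c`; only the values of `φ` on the zero
locus are constrained or used. -/
structure IsKL (R : Cᵒᵖ ⥤ CommAlgCat.{w} ℚ) : Prop where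
  exists_poly : ∀ (σ : Type) [Finite σ] (I : Ideal (MvPolynomial σ ℚ)), IsWeilIdeal I →
    ∀ (c : C) (φ : ∀ d : C, (d ⟶ c) → (σ → R.obj (op d)) → R.obj (op d)),
      (∀ (d e : C) (f : d ⟶ c) (g : e ⟶ d), ∀ x ∈ zeroLocus R I d,
        φ e (g ≫ f) (resVec R g x) = (R.map g.op).hom (φ d f x)) →
      ∃ p : MvPolynomial σ (R.obj (op c)), ∀ (d : C) (f : d ⟶ c), ∀ x ∈ zeroLocus R I d,
        φ d f x = MvPolynomial.eval₂ (R.map f.op).hom.toRingHom x p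
  unique : ∀ (σ : Type) [Finite σ] (I : Ideal (MvPolynomial σ ℚ)), IsWeilIdeal I →
    ∀ (c : C) (p : MvPolynomial σ (R.obj (op c))),
      (∀ (d : C) (f : d ⟶ c), ∀ x ∈ zeroLocus R I d,
        MvPolynomial.eval₂ (R.map f.op).hom.toRingHom x p = 0) →
      p ∈ I.map (MvPolynomial.map (algebraMap ℚ (R.obj (op c))))

/-- First order neighbours in `Rⁿ`: `y - x` belongs to `D(n)`, i.e. all products of two of its
coordinates (squares included) vanish. -/
def VecNbr {A : Type*} [CommRing A] {n : ℕ} (x y : Fin n → A) : Prop :=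
  ∀ i j : Fin n, (y i - x i) * (y j - x j) = 0

end Scalars

/-! ### Formal manifolds -/

section Manifolds

variable {C : Type u} [Category.{v} C]

/-- A (stagewise) binary relation on a presheaf of sets. -/
abbrev StageRel (M : Cᵒᵖ ⥤ Type t) := ∀ c : C, M.obj (op c) → M.obj (op c) → Prop

/-- The total relation, in which any two points are neighbours. -/
def totalRel (M : Cᵒᵖ ⥤ Type t) : StageRel M := fun _ _ _ => True

/-- `M` is a formal manifold over the ring object `R`: it is covered by charts
`ψ i : V i ↪ M`, where `V i` is a formally open subobject of some `Rⁿ` and the image of `ψ i` is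
formally open in `M`. (A subobject is formally open if it is closed under the first order
neighbour relation.) -/
structure FormalAtlas (J : GrothendieckTopology C) (R : Cᵒᵖ ⥤ CommAlgCat.{w} ℚ)
    (M : Cᵒᵖ ⥤ Type t) where
  /-- the set of charts -/
  ι : Type s
  /-- the dimension of a chart -/
  dim : ι → ℕ
  /-- the coordinate domain `V i ⊆ R ^ dim i`, at each stage -/
  dom : ∀ (i : ι) (c : C), Set (Fin (dim i) → R.obj (op c))
  dom_res : ∀ (i : ι) {c d : C} (f : d ⟶ c), ∀ x ∈ dom i c, resVec R f x ∈ dom i d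
  dom_local : ∀ (i : ι) (c : C) (x : Fin (dim i) → R.obj (op c)), ∀ S ∈ J c,
    (∀ (d : C) (f : d ⟶ c), S f → resVec R f x ∈ dom i d) → x ∈ dom i c
  dom_open : ∀ (i : ι) (c : C), ∀ x ∈ dom i c, ∀ y, VecNbr x y → y ∈ dom i c
  /-- the parametrization; only its values on `dom i` matter -/
  ψ : ∀ (i : ι) (c : C), (Fin (dim i) → R.obj (op c)) → M.obj (op c)
  ψ_res : ∀ (i : ι) {c d : C} (f : d ⟶ c), ∀ x ∈ dom i c,
    ψ i d (resVec R f x) = M.map f.op (ψ i c x)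
  ψ_inj : ∀ (i : ι) (c : C), Set.InjOn (ψ i c) (dom i c)
  /-- the images of the charts are formally open in `M` -/
  ψ_open : ∀ (i j : ι) (c : C), ∀ x ∈ dom i c, ∀ x' ∈ dom j c, ∀ y' ∈ dom j c,
    ψ i c x = ψ j c x' → VecNbr x' y' → ∃ y ∈ dom i c, ψ i c y = ψ j c y'
  /-- the charts cover `M` -/
  cover : ∀ (c : C) (m : M.obj (op c)), ∃ S ∈ J c, ∀ (d : C) (f : d ⟶ c), S f →
    ∃ (i : ι), ∃ x ∈ dom i d, ψ i d x = M.map f.op m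

/-- The first order neighbour relation `∼` of a formal manifold: locally, the two points have
neighbouring coordinates in some chart. -/
def FormalAtlas.nbr {J : GrothendieckTopology C} {R : Cᵒᵖ ⥤ CommAlgCat.{w} ℚ}
    {M : Cᵒᵖ ⥤ Type t} (𝒜 : FormalAtlas.{v, u, w, t, s} J R M) : StageRel M :=
  fun c m m' => ∃ S ∈ J c, ∀ (d : C) (f : d ⟶ c), S f →
    ∃ (i : 𝒜.ι), ∃ x ∈ 𝒜.dom i d, ∃ y ∈ 𝒜.dom i d,
      𝒜.ψ i d x = M.map f.op m ∧ 𝒜.ψ i d y = M.map f.op m' ∧ VecNbr x y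

end Manifolds

/-! ### Paths, transport and grids -/

/-- `(p 0, …, p n)` is an `n`-path for the relation `r`. -/
def IsPath {X : Type*} (r : X → X → Prop) (n : ℕ) (p : ℕ → X) : Prop :=
  ∀ i < n, r (p i) (p (i + 1))

/-- Iterated transport of `z` along `y 0, y 1, …`, for the ternary operation
`par x y z = [z x y]`. -/
def transport {X : Type*} (par : X → X → X → X) (y : ℕ → X) (z : X) : ℕ → X
  | 0 => z
  | j + 1 => par (y j) (y (j + 1)) (transport par y z j)

/-- The grid `u i j` spanned by two paths `y` and `z` with common domain: `u 0 j = y j`,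
`u i 0 = z i` and `u (i+1) (j+1) = [u (i+1) j, u i j, u i (j+1)]`. -/
def grid {X : Type*} (par : X → X → X → X) (y z : ℕ → X) : ℕ → ℕ → X
  | 0 => y
  | i + 1 => transport par (grid par y z i) (z (i + 1))

theorem grid_zero_left {X : Type*} (par : X → X → X → X) (y z : ℕ → X) (j : ℕ) :
    grid par y z 0 j = y j := rfl

theorem grid_zero_right {X : Type*} (par : X → X → X → X) (y z : ℕ → X) (h : y 0 = z 0) (i : ℕ) :
    grid par y z i 0 = z i := by
  cases i with
  | zero => exact h
  | succ i => rfl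

theorem grid_succ_succ {X : Type*} (par : X → X → X → X) (y z : ℕ → X) (i j : ℕ) :
    grid par y z (i + 1) (j + 1) =
      par (grid par y z i j) (grid par y z i (j + 1)) (grid par y z (i + 1) j) := rfl

/-! ### Affine connections -/

section Connections

variable {C : Type u} [Category.{v} C]

/-- `M` is path connected for `r`: any two points are, locally, joined by an `n`-path for
some `n`. -/
def PathConnected (J : GrothendieckTopology C) (M : Cᵒᵖ ⥤ Type t) (r : StageRel M) : Prop :=
  ∀ (c : C) (x y : M.obj (op c)), ∃ S ∈ J c, ∀ (d : C) (f : d ⟶ c), S f →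
    ∃ (n : ℕ) (p : ℕ → M.obj (op d)),
      IsPath (r d) n p ∧ p 0 = M.map f.op x ∧ p n = M.map f.op y

/-- An affine connection on `(M, r)`: a ternary operation `par x y z = [z x y]`, defined when
`x ∼ y` and `x ∼ z`, natural in the stage, with `[z x y] ∼ y`, `[z x y] ∼ z`, `[z x x] = z`,
`[x x y] = y` and `[[z x y] y x] = z`. Values of `par` outside the domain of definition are
unconstrained and never used. -/
@[ext]
structure AffineConnection (M : Cᵒᵖ ⥤ Type t) (r : StageRel M) where
  par : ∀ (c : C), M.obj (op c) → M.obj (op c) → M.obj (op c) → M.obj (op c)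
  par_res : ∀ {c d : C} (f : d ⟶ c) (x y z : M.obj (op c)), r c x y → r c x z →
    M.map f.op (par c x y z) = par d (M.map f.op x) (M.map f.op y) (M.map f.op z)
  book_left : ∀ {c : C} (x y z : M.obj (op c)), r c x y → r c x z → r c (par c x y z) y
  book_right : ∀ {c : C} (x y z : M.obj (op c)), r c x y → r c x z → r c (par c x y z) z
  unit_left : ∀ {c : C} (x z : M.obj (op c)), r c x z → par c x x z = z
  unit_right : ∀ {c : C} (x y : M.obj (op c)), r c x y → par c x y x = y
  inversion : ∀ {c : C} (x y z : M.obj (op c)), r c x y → r c x z →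
    par c y x (par c x y z) = z

namespace AffineConnection

variable {M : Cᵒᵖ ⥤ Type t} {r : StageRel M}

/-- Symmetry (torsion freeness): `[z x y] = [y x z]`. -/
def IsSymmetric (l : AffineConnection M r) : Prop :=
  ∀ (c : C) (x y z : M.obj (op c)), r c x y → r c x z → l.par c x y z = l.par c x z y

/-- Flatness (curvature freeness): with `∇(x,y) = [- x y] : 𝔐(x) → 𝔐(y)`, one has
`∇(x,y).∇(y,z) = ∇(x,z)` (composing from left to right) for mutual neighbours `x, y, z`. -/
def IsFlat (l : AffineConnection M r) : Prop :=
  ∀ (c : C) (x y z : M.obj (op c)), r c x y → r c y z → r c x z →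
    ∀ a : M.obj (op c), r c x a → l.par c y z (l.par c x y a) = l.par c x z a

/-- Flatness with respect to parallelograms: transporting `z ∼ x` along the two sides
`x, a, [a x b]` and `x, b, [b x a]` of a parallelogram gives the same result,
`[[z x a] a [a x b]] = [[z x b] b [b x a]]`. -/
def IsFlatOnParallelograms (l : AffineConnection M r) : Prop :=
  ∀ (c : C) (x a b z : M.obj (op c)), r c x a → r c x b → r c x z →
    l.par c a (l.par c x b a) (l.par c x a z) = l.par c b (l.par c x a b) (l.par c x b z)

/-- `L` is everywhere defined, and `[z x y]` for `L` is the codomain of the `l`-grid spanned by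
any path from `x` to `y` and any path from `x` to `z`. -/
def IsGridExtension (l : AffineConnection M r) (L : AffineConnection M (totalRel M)) : Prop :=
  ∀ (c : C) (n m : ℕ) (y z : ℕ → M.obj (op c)), IsPath (r c) n y → IsPath (r c) m z →
    y 0 = z 0 → L.par c (y 0) (y n) (z m) = grid (l.par c) y z m n

end AffineConnection

end Connections

end Kock

/-! The point is that the codomain of a grid depends only on the end points of its two spanning
paths. Grids then define `Λ`, and its algebra is read off from grids.

A formally open chart contains every neighbour of each of its points, so a whole grid lies in any
chart containing its initial point, and independence may be proved in coordinates. There,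
`IsLocalConnection.par_par_eq` treats two consecutive steps `u`, `v`. By Kock–Lawvere the transport
is biaffine in `(u, v)`, its two linear parts coincide, and flatness makes its bilinear part vanish
whenever `u + v` is infinitesimal too. This forces the bilinear part to be symmetric, so the
transport is a function of `u + v` alone, although `u + v` need not be first order.

Hence the order of the vertical displacements of a grid is irrelevant, and zero displacements may be
inserted. A natural function of infinitesimal vectors with these two invariances has a Taylor
formula in their sum (`IsSymmetricFamily.eq_of_sum_eq`; the factorials are invertible since `R` is a
ℚ-algebra). So only the end point of the vertical path matters, and symmetry of `λ` transposes the
grid to give the same for the horizontal path (`FormalAtlas.grid_eq`).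

Paths exist only locally, so the values are glued in the sheaf `M`. Placing two grids side by side
gives `[[zxa]ab] = [zxb]` (`gridValues_comp`), from which inversion and flatness on parallelograms
follow. -/

namespace Kock

/-! ### First order consequences of the Kock–Lawvere axiom. -/

section Scalars

variable {C : Type u} [Category.{v} C]

/-- First order infinitesimal vectors: all products of two coordinates vanish. -/
def IsInfinitesimal {A : Type*} [CommRing A] {n : ℕ} (v : Fin n → A) : Prop :=
  ∀ i j : Fin n, v i * v j = 0

section Vectors

variable {A : Type*} [CommRing A] {n : ℕ} {x y v : Fin n → A}

theorem vecNbr_iff : VecNbr x y ↔ IsInfinitesimal (y - x) := Iff.rfl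

theorem vecNbr_add (x : Fin n → A) (hv : IsInfinitesimal v) : VecNbr x (x + v) := by
  simpa [vecNbr_iff] using hv

theorem VecNbr.refl (x : Fin n → A) : VecNbr x x := fun i j => by simp

theorem VecNbr.symm (h : VecNbr x y) : VecNbr y x := fun i j => by
  linear_combination h i j

theorem isInfinitesimal_zero : IsInfinitesimal (0 : Fin n → A) := fun i j => by simp

theorem IsInfinitesimal.sum_mul_sum (hv : IsInfinitesimal v) (a b : Fin n → A) :
    (∑ i, a i * v i) * (∑ i, b i * v i) = 0 := by
  rw [Finset.sum_mul_sum]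
  refine Finset.sum_eq_zero fun i _ => Finset.sum_eq_zero fun j _ => ?_
  linear_combination a i * b j * hv i j

theorem isInfinitesimal_single (i : Fin n) {a : A} (ha : a * a = 0) :
    IsInfinitesimal (Pi.single i a : Fin n → A) := by
  intro j k
  by_cases hj : j = i
  · by_cases hk : k = i
    · subst hj; subst hk; simpa using ha
    · simp [Pi.single_eq_of_ne hk]
  · simp [Pi.single_eq_of_ne hj]

theorem sum_mul_single (i : Fin n) (b : Fin n → A) (a : A) :
    ∑ j, b j * (Pi.single i a : Fin n → A) j = b i * a := by
  rw [Finset.sum_eq_single i]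
  · simp
  · intro j _ hj
    simp [Pi.single_eq_of_ne hj]
  · simp

end Vectors

variable (R : Cᵒᵖ ⥤ CommAlgCat.{w} ℚ)

theorem map_comp_hom {c d e : C} (f : d ⟶ c) (g : e ⟶ d) (a : R.obj (op c)) :
    (R.map (g ≫ f).op).hom a = (R.map g.op).hom ((R.map f.op).hom a) := by
  simp

theorem map_id_hom {c : C} (a : R.obj (op c)) : (R.map (𝟙 c).op).hom a = a := by
  simp

theorem resVec_comp {σ : Type} {c d e : C} (f : d ⟶ c) (g : e ⟶ d) (x : σ → R.obj (op c)) :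
    resVec R (g ≫ f) x = resVec R g (resVec R f x) :=
  funext fun _ => map_comp_hom R f g _

theorem resVec_id {σ : Type} {c : C} (x : σ → R.obj (op c)) : resVec R (𝟙 c) x = x :=
  funext fun _ => map_id_hom R _

theorem resVec_add {σ : Type} {c d : C} (f : d ⟶ c) (x y : σ → R.obj (op c)) :
    resVec R f (x + y) = resVec R f x + resVec R f y :=
  funext fun _ => map_add _ _ _

theorem resVec_sub {σ : Type} {c d : C} (f : d ⟶ c) (x y : σ → R.obj (op c)) :
    resVec R f (x - y) = resVec R f x - resVec R f y :=
  funext fun _ => map_sub _ _ _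

theorem resVec_zero {σ : Type} {c d : C} (f : d ⟶ c) :
    resVec R f (0 : σ → R.obj (op c)) = 0 :=
  funext fun _ => map_zero _

variable {R}

theorem IsInfinitesimal.res {n : ℕ} {c d : C} (f : d ⟶ c) {v : Fin n → R.obj (op c)}
    (hv : IsInfinitesimal v) : IsInfinitesimal (resVec R f v) := fun i j => by
  simp only [resVec]
  rw [← map_mul, hv, map_zero]

theorem VecNbr.res {n : ℕ} {c d : C} (f : d ⟶ c) {x y : Fin n → R.obj (op c)}
    (h : VecNbr x y) : VecNbr (resVec R f x) (resVec R f y) := by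
  rw [vecNbr_iff, ← resVec_sub]
  exact IsInfinitesimal.res f h

theorem mem_zeroLocus_sq_iff {n : ℕ} {c : C} (x : Fin n → R.obj (op c)) :
    x ∈ zeroLocus R
      ((Ideal.span (Set.range (MvPolynomial.X : Fin n → MvPolynomial (Fin n) ℚ))) ^ 2) c ↔
      IsInfinitesimal x := by
  constructor
  · intro h i j
    have := h (MvPolynomial.X i * MvPolynomial.X j) (by
      rw [pow_two]
      exact Ideal.mul_mem_mul (Ideal.subset_span ⟨i, rfl⟩) (Ideal.subset_span ⟨j, rfl⟩))
    simpa using this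
  · intro h p hp
    rw [pow_two, Ideal.span_mul_span'] at hp
    refine (Ideal.span_le (I := RingHom.ker (MvPolynomial.aeval (R := ℚ) x))).2 ?_ hp
    rintro _ ⟨_, ⟨i, rfl⟩, _, ⟨j, rfl⟩, rfl⟩
    simpa using h i j

/-- Monomials of degree at least two vanish on infinitesimal vectors. The coefficients are chosen at
stage `c`, once for all later stages. -/
theorem exists_affine_eval {n : ℕ} {c : C} (p : MvPolynomial (Fin n) (R.obj (op c))) :
    ∃ (a₀ : R.obj (op c)) (a : Fin n → R.obj (op c)), ∀ (d : C) (f : d ⟶ c)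
      (x : Fin n → R.obj (op d)), IsInfinitesimal x →
        MvPolynomial.eval₂ (R.map f.op).hom.toRingHom x p =
          (R.map f.op).hom a₀ + ∑ j, (R.map f.op).hom (a j) * x j := by
  induction p using MvPolynomial.induction_on with
  | C r => exact ⟨r, 0, fun d f x _ => by simp⟩
  | add p q hp hq =>
    obtain ⟨a₀, a, ha⟩ := hp
    obtain ⟨b₀, b, hb⟩ := hq
    refine ⟨a₀ + b₀, a + b, fun d f x hx => ?_⟩
    rw [MvPolynomial.eval₂_add, ha d f x hx, hb d f x hx]
    simp only [map_add, Pi.add_apply, add_mul, Finset.sum_add_distrib]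
    ring
  | mul_X p i hp =>
    obtain ⟨a₀, a, ha⟩ := hp
    refine ⟨0, Pi.single i a₀, fun d f x hx => ?_⟩
    rw [MvPolynomial.eval₂_mul, ha d f x hx, MvPolynomial.eval₂_X, add_mul, Finset.sum_mul,
      Finset.sum_eq_zero (s := Finset.univ) (f := fun j => _ * x i), map_zero, zero_add, add_zero,
      Finset.sum_eq_single i]
    · simp
    · intro j _ hj
      simp [Pi.single_eq_of_ne hj]
    · simp
    · intro j _
      rw [mul_assoc, hx, mul_zero]

/-- A natural family of functions on first order infinitesimal vectors is affine. -/
theorem IsKL.exists_affine (hKL : IsKL R) {n : ℕ} {c : C}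
    (G : ∀ d : C, (d ⟶ c) → (Fin n → R.obj (op d)) → R.obj (op d))
    (hG : ∀ (d e : C) (f : d ⟶ c) (g : e ⟶ d) (x : Fin n → R.obj (op d)), IsInfinitesimal x →
      G e (g ≫ f) (resVec R g x) = (R.map g.op).hom (G d f x)) :
    ∃ (a₀ : R.obj (op c)) (a : Fin n → R.obj (op c)), ∀ (d : C) (f : d ⟶ c)
      (x : Fin n → R.obj (op d)), IsInfinitesimal x →
        G d f x = (R.map f.op).hom a₀ + ∑ j, (R.map f.op).hom (a j) * x j := by
  obtain ⟨p, hp⟩ := hKL.exists_poly (Fin n)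
    ((Ideal.span (Set.range (MvPolynomial.X : Fin n → MvPolynomial (Fin n) ℚ))) ^ 2)
    ⟨Ideal.pow_le_self two_ne_zero, 2, le_rfl⟩ c G
    (fun d e f g x hx => hG d e f g x ((mem_zeroLocus_sq_iff x).1 hx))
  obtain ⟨a₀, a, ha⟩ := exists_affine_eval p
  exact ⟨a₀, a, fun d f x hx => by
    rw [hp d f x ((mem_zeroLocus_sq_iff x).2 hx), ha d f x hx]⟩

/-- Universally quantified elements of square zero may be cancelled. -/
theorem IsKL.cancel (hKL : IsKL R) {c : C} (a : R.obj (op c))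
    (h : ∀ (d : C) (f : d ⟶ c) (t : R.obj (op d)), t * t = 0 → (R.map f.op).hom a * t = 0) :
    a = 0 := by
  have hmem := hKL.unique (Fin 1)
    ((Ideal.span (Set.range (MvPolynomial.X : Fin 1 → MvPolynomial (Fin 1) ℚ))) ^ 2)
    ⟨Ideal.pow_le_self two_ne_zero, 2, le_rfl⟩ c (MvPolynomial.C a * MvPolynomial.X 0)
    (fun d f x hx => by
      simpa using h d f (x 0) ((mem_zeroLocus_sq_iff x).1 hx 0 0))
  -- Sending the variable to `ε` in the dual numbers kills the extended ideal, while `a X` goes to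
  -- `a ε`, whose `ε`-coefficient is `a`.
  have hle : (((Ideal.span (Set.range (MvPolynomial.X : Fin 1 → MvPolynomial (Fin 1) ℚ))) ^ 2).map
      (MvPolynomial.map (algebraMap ℚ (R.obj (op c))))) ≤ RingHom.ker (MvPolynomial.aeval
        (R := R.obj (op c)) (fun _ : Fin 1 => (DualNumber.eps : DualNumber (R.obj (op c))))) := by
    rw [pow_two, Ideal.span_mul_span', Ideal.map_span, Ideal.span_le]
    rintro _ ⟨_, ⟨_, ⟨i, rfl⟩, _, ⟨j, rfl⟩, rfl⟩, rfl⟩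
    simp
  have := congrArg TrivSqZeroExt.snd (hle hmem)
  simpa [TrivSqZeroExt.algebraMap_eq_inl] using this

theorem IsKL.cancel_sum (hKL : IsKL R) {n : ℕ} {c : C} (a : Fin n → R.obj (op c))
    (h : ∀ (d : C) (f : d ⟶ c) (x : Fin n → R.obj (op d)), IsInfinitesimal x →
      ∑ j, (R.map f.op).hom (a j) * x j = 0) : a = 0 := by
  funext i
  refine hKL.cancel _ fun d f t ht => ?_
  have := h d f (Pi.single i t) (isInfinitesimal_single i ht)
  rwa [sum_mul_single i fun j => (R.map f.op).hom (a j)] at this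

end Scalars

/-! ### Taylor formula for symmetric functions of infinitesimal vectors. -/

section SymmetricFamilies

variable {C : Type u} [Category.{v} C] {R : Cᵒᵖ ⥤ CommAlgCat.{w} ℚ} {n : ℕ} {c : C}

/-- A scalar valued function of finite sequences of vectors, at all stages over `c`. -/
abbrev ListFun (R : Cᵒᵖ ⥤ CommAlgCat.{w} ℚ) (n : ℕ) (c : C) :=
  ∀ d : C, (d ⟶ c) → List (Fin n → R.obj (op d)) → R.obj (op d)

/-- Naturality, invariance under permutation, and invariance under insertion of a zero vector,
for a function of finite sequences of first order infinitesimal vectors. -/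
structure IsSymmetricFamily (F : ListFun R n c) : Prop where
  res : ∀ (d e : C) (f : d ⟶ c) (g : e ⟶ d) (l : List (Fin n → R.obj (op d))),
    (∀ v ∈ l, IsInfinitesimal v) → F e (g ≫ f) (l.map (resVec R g)) = (R.map g.op).hom (F d f l)
  perm : ∀ (d : C) (f : d ⟶ c) (l l' : List (Fin n → R.obj (op d))),
    (∀ v ∈ l, IsInfinitesimal v) → l.Perm l' → F d f l = F d f l'
  zero : ∀ (d : C) (f : d ⟶ c) (l : List (Fin n → R.obj (op d))),
    (∀ v ∈ l, IsInfinitesimal v) → F d f (0 :: l) = F d f l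

/-- `a` is the gradient at `l` of `F` with respect to an additional vector. -/
def IsGradient (F : ListFun R n c) (d : C) (f : d ⟶ c) (l : List (Fin n → R.obj (op d)))
    (a : Fin n → R.obj (op d)) : Prop :=
  (∀ v ∈ l, IsInfinitesimal v) ∧ ∀ (e : C) (g : e ⟶ d) (x : Fin n → R.obj (op e)),
    IsInfinitesimal x → F e (g ≫ f) (x :: l.map (resVec R g)) =
      F e (g ≫ f) (l.map (resVec R g)) + ∑ j, (R.map g.op).hom (a j) * x j

theorem map_resVec_isInfinitesimal {d e : C} (g : e ⟶ d) {l : List (Fin n → R.obj (op d))}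
    (hl : ∀ v ∈ l, IsInfinitesimal v) : ∀ v ∈ l.map (resVec R g), IsInfinitesimal v := by
  intro v hv
  obtain ⟨x, hx, rfl⟩ := List.mem_map.1 hv
  exact (hl x hx).res g

theorem map_resVec_comp {d e e' : C} (g : e ⟶ d) (h : e' ⟶ e)
    (l : List (Fin n → R.obj (op d))) :
    l.map (resVec R (h ≫ g)) = (l.map (resVec R g)).map (resVec R h) := by
  rw [List.map_map]
  exact List.map_congr_left fun x _ => resVec_comp R g h x

theorem map_resVec_id {d : C} (l : List (Fin n → R.obj (op d))) :
    l.map (resVec R (𝟙 d)) = l := by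
  rw [show resVec R (𝟙 d) = (id : (Fin n → R.obj (op d)) → _) from funext (resVec_id R),
    List.map_id]

theorem forall_cons_isInfinitesimal {d : C} {x : Fin n → R.obj (op d)}
    {l : List (Fin n → R.obj (op d))} (hx : IsInfinitesimal x)
    (hl : ∀ v ∈ l, IsInfinitesimal v) : ∀ v ∈ x :: l, IsInfinitesimal v :=
  List.forall_mem_cons.2 ⟨hx, hl⟩

theorem IsSymmetricFamily.exists_gradient (hKL : IsKL R) {F : ListFun R n c}
    (hF : IsSymmetricFamily F) (d : C) (f : d ⟶ c) (l : List (Fin n → R.obj (op d)))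
    (hl : ∀ v ∈ l, IsInfinitesimal v) : ∃ a, IsGradient F d f l a := by
  obtain ⟨a₀, a, ha⟩ := hKL.exists_affine (c := d)
    (fun e g x => F e (g ≫ f) (x :: l.map (resVec R g))) (by
      intro e e' g h x hx
      rw [← hF.res _ _ _ h _ (forall_cons_isInfinitesimal hx (map_resVec_isInfinitesimal g hl)),
        List.map_cons, ← map_resVec_comp, Category.assoc])
  refine ⟨a, hl, fun e g x hx => ?_⟩
  -- The constant term is identified by evaluating at the zero vector, which may be dropped from the
  -- sequence.
  have h0 := ha e g 0 isInfinitesimal_zero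
  rw [hF.zero _ _ _ (map_resVec_isInfinitesimal g hl)] at h0
  rw [ha e g x hx, h0]
  simp

theorem IsGradient.unique (hKL : IsKL R) {F : ListFun R n c} {d : C} {f : d ⟶ c}
    {l : List (Fin n → R.obj (op d))} {a b : Fin n → R.obj (op d)} (ha : IsGradient F d f l a)
    (hb : IsGradient F d f l b) : a = b := by
  rw [← sub_eq_zero]
  refine hKL.cancel_sum _ fun e g x hx => ?_
  have := (ha.2 e g x hx).symm.trans (hb.2 e g x hx)
  simp only [Pi.sub_apply, map_sub, sub_mul, Finset.sum_sub_distrib]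
  linear_combination this

open Classical in
/-- The partial derivatives of a function of finite sequences of vectors, with respect to an
additional vector. -/
noncomputable def partialDeriv (F : ListFun R n c) (j : Fin n) : ListFun R n c :=
  fun d f l => if h : ∃ a, IsGradient F d f l a then h.choose j else 0

theorem IsGradient.partialDeriv_eq (hKL : IsKL R) {F : ListFun R n c} {d : C} {f : d ⟶ c}
    {l : List (Fin n → R.obj (op d))} {a : Fin n → R.obj (op d)} (ha : IsGradient F d f l a)
    (j : Fin n) : partialDeriv F j d f l = a j := by
  have h : ∃ a, IsGradient F d f l a := ⟨a, ha⟩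
  rw [partialDeriv, dif_pos h, h.choose_spec.unique hKL ha]

theorem IsSymmetricFamily.isGradient (hKL : IsKL R) {F : ListFun R n c}
    (hF : IsSymmetricFamily F) (d : C) (f : d ⟶ c) (l : List (Fin n → R.obj (op d)))
    (hl : ∀ v ∈ l, IsInfinitesimal v) :
    IsGradient F d f l (fun j => partialDeriv F j d f l) := by
  obtain ⟨a, ha⟩ := hF.exists_gradient hKL d f l hl
  rwa [show (fun j => partialDeriv F j d f l) = a from funext fun j => ha.partialDeriv_eq hKL j]

theorem IsSymmetricFamily.apply_cons (hKL : IsKL R) {F : ListFun R n c}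
    (hF : IsSymmetricFamily F) {d : C} (f : d ⟶ c) {l : List (Fin n → R.obj (op d))}
    (hl : ∀ v ∈ l, IsInfinitesimal v) {x : Fin n → R.obj (op d)} (hx : IsInfinitesimal x) :
    F d f (x :: l) = F d f l + ∑ j, partialDeriv F j d f l * x j := by
  have := (hF.isGradient hKL d f l hl).2 d (𝟙 d) x hx
  simpa only [Category.id_comp, map_resVec_id, map_id_hom] using this

/-- Gradients are unique, so each invariance of `F` passes to its derivatives; this is what permits
iterated differentiation. -/
theorem IsSymmetricFamily.partialDeriv (hKL : IsKL R) {F : ListFun R n c}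
    (hF : IsSymmetricFamily F) (j : Fin n) : IsSymmetricFamily (partialDeriv F j) where
  res d e f g l hl := by
    have h := hF.isGradient hKL d f l hl
    refine IsGradient.partialDeriv_eq hKL (a := resVec R g fun j => Kock.partialDeriv F j d f l)
      ⟨map_resVec_isInfinitesimal g hl, fun e' h' x hx => ?_⟩ j
    have := h.2 e' (h' ≫ g) x hx
    simpa only [Category.assoc, map_resVec_comp, map_comp_hom, resVec] using this
  perm d f l l' hl hll := by
    have hl' : ∀ v ∈ l', IsInfinitesimal v := fun v hv => hl v (hll.mem_iff.2 hv)
    refine IsGradient.partialDeriv_eq hKL (a := fun j => Kock.partialDeriv F j d f l')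
      ⟨hl, fun e g x hx => ?_⟩ j
    rw [hF.perm _ _ _ _ (map_resVec_isInfinitesimal g hl) (hll.map _),
      hF.perm _ _ _ _ (forall_cons_isInfinitesimal hx (map_resVec_isInfinitesimal g hl))
        ((hll.map _).cons _)]
    exact (hF.isGradient hKL d f l' hl').2 e g x hx
  zero d f l hl := by
    have h0 : ∀ (e : C), IsInfinitesimal (0 : Fin n → R.obj (op e)) :=
      fun e => isInfinitesimal_zero
    refine IsGradient.partialDeriv_eq hKL (a := fun j => Kock.partialDeriv F j d f l)
      ⟨forall_cons_isInfinitesimal (h0 d) hl, fun e g x hx => ?_⟩ j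
    have hl' := map_resVec_isInfinitesimal g hl
    rw [List.map_cons, resVec_zero, hF.zero _ _ _ hl',
      hF.perm _ _ _ _ (forall_cons_isInfinitesimal hx (forall_cons_isInfinitesimal (h0 e) hl'))
        (List.Perm.swap _ _ _), hF.zero _ _ _ (forall_cons_isInfinitesimal hx hl')]
    exact (hF.isGradient hKL d f l hl).2 e g x hx

/-- Prepend `t eᵢ` and `r eⱼ` with `t² = r² = 0` in both orders and compare the coefficients of `t
r`; then cancel `r` and `t`. -/
theorem IsSymmetricFamily.partialDeriv_comm (hKL : IsKL R) {F : ListFun R n c}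
    (hF : IsSymmetricFamily F) (i j : Fin n) :
    Kock.partialDeriv (Kock.partialDeriv F j) i = Kock.partialDeriv (Kock.partialDeriv F i) j := by
  funext d f l
  by_cases hl : ∀ v ∈ l, IsInfinitesimal v
  · rw [← sub_eq_zero]
    refine hKL.cancel _ fun e g t ht => ?_
    rw [map_sub]
    refine hKL.cancel _ fun e' h r hr => ?_
    have hij (i j : Fin n) := ((hF.partialDeriv hKL j).partialDeriv hKL i).res d e' f (h ≫ g) l hl
    rw [map_mul, map_sub, ← map_comp_hom, ← map_comp_hom, ← hij, ← hij]
    set l' := l.map (resVec R (h ≫ g))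
    have hl' : ∀ v ∈ l', IsInfinitesimal v := map_resVec_isInfinitesimal _ hl
    set t' := (R.map h.op).hom t
    have ht' : t' * t' = 0 := by rw [← map_mul, ht, map_zero]
    have hx := isInfinitesimal_single i ht'
    have hy := isInfinitesimal_single j hr
    have h1 := hF.perm _ ((h ≫ g) ≫ f) _ _
      (forall_cons_isInfinitesimal hx (forall_cons_isInfinitesimal hy hl'))
      (List.Perm.swap _ _ _)
    rw [hF.apply_cons hKL _ (forall_cons_isInfinitesimal hy hl') hx,
      hF.apply_cons hKL _ (forall_cons_isInfinitesimal hx hl') hy,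
      hF.apply_cons hKL _ hl' hx, hF.apply_cons hKL _ hl' hy, sum_mul_single, sum_mul_single,
      sum_mul_single, sum_mul_single, (hF.partialDeriv hKL i).apply_cons hKL _ hl' hy,
      (hF.partialDeriv hKL j).apply_cons hKL _ hl' hx, sum_mul_single, sum_mul_single] at h1
    linear_combination -h1
  -- `IsGradient` requires an infinitesimal sequence, so otherwise both sides take the default value
  -- `0`.
  · rw [Kock.partialDeriv, Kock.partialDeriv, dif_neg, dif_neg]
    · rintro ⟨a, ha⟩
      exact hl ha.1
    · rintro ⟨a, ha⟩
      exact hl ha.1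

/-- The `k`-th differential at the empty sequence, evaluated on the diagonal. -/
noncomputable def diagDifferential : ℕ → ListFun R n c → (Fin n → R.obj (op c)) → R.obj (op c)
  | 0, F, _ => F c (𝟙 c) []
  | k + 1, F, x => ∑ j, x j * diagDifferential k (partialDeriv F j) x

/-- The binomial expansion stops after the term linear in `y` because all `y i * y j` vanish;
commuting derivatives produce the factor `k + 1`. No condition is put on `x`, which will be a sum of
infinitesimal vectors. -/
theorem IsSymmetricFamily.diagDifferential_add (hKL : IsKL R) (k : ℕ)
    {F : ListFun R n c} (hF : IsSymmetricFamily F) (x y : Fin n → R.obj (op c))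
    (hy : IsInfinitesimal y) :
    diagDifferential (k + 1) F (x + y) = diagDifferential (k + 1) F x +
      (k + 1 : ℚ) • ∑ j, y j * diagDifferential k (Kock.partialDeriv F j) x := by
  induction k generalizing F with
  | zero =>
    simp only [diagDifferential, Pi.add_apply, add_mul, Finset.sum_add_distrib]
    simp
  | succ k ih =>
    set B : R.obj (op c) :=
      ∑ j, y j * diagDifferential (k + 1) (Kock.partialDeriv F j) x with hB
    have hvan (i : Fin n) : y i * ∑ j, y j * diagDifferential k
        (Kock.partialDeriv (Kock.partialDeriv F i) j) x = 0 := by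
      rw [Finset.mul_sum]
      refine Finset.sum_eq_zero fun j _ => ?_
      rw [← mul_assoc, hy, zero_mul]
    have hswap : ∑ i, x i * ∑ j, y j * diagDifferential k
        (Kock.partialDeriv (Kock.partialDeriv F i) j) x = B := by
      simp only [hB, diagDifferential, Finset.mul_sum]
      rw [Finset.sum_comm]
      refine Finset.sum_congr rfl fun j _ => Finset.sum_congr rfl fun i _ => ?_
      rw [hF.partialDeriv_comm hKL j i]
      ring
    have hstep : diagDifferential (k + 1 + 1) F (x + y) =
        ∑ i, (x i * diagDifferential (k + 1) (Kock.partialDeriv F i) x +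
          y i * diagDifferential (k + 1) (Kock.partialDeriv F i) x +
          (k + 1 : ℚ) • (x i * ∑ j, y j * diagDifferential k
            (Kock.partialDeriv (Kock.partialDeriv F i) j) x)) := by
      rw [diagDifferential]
      refine Finset.sum_congr rfl fun i _ => ?_
      rw [ih (hF.partialDeriv hKL i), Pi.add_apply, add_mul, mul_add, mul_add, mul_smul_comm,
        mul_smul_comm, hvan i, smul_zero]
      abel
    rw [hstep, Finset.sum_add_distrib, Finset.sum_add_distrib, ← Finset.smul_sum, hswap, ← hB,
      add_assoc]
    congr 1
    push_cast
    simp only [add_smul, one_smul]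
    abel

/-- The Taylor formula at the empty sequence. The bound `K` is any number at least the length, so
that two sequences of different lengths can share one truncation. -/
theorem IsSymmetricFamily.eq_sum_diagDifferential (hKL : IsKL R)
    (l : List (Fin n → R.obj (op c))) (hl : ∀ v ∈ l, IsInfinitesimal v) (K : ℕ)
    (hK : l.length ≤ K) {F : ListFun R n c} (hF : IsSymmetricFamily F) :
    F c (𝟙 c) l =
      ∑ k ∈ Finset.range (K + 1), (k.factorial : ℚ)⁻¹ • diagDifferential k F l.sum := by
  induction l generalizing K F with
  | nil =>
    rw [Finset.sum_range_succ', Finset.sum_eq_zero]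
    · simp [diagDifferential]
    · intro k _
      simp [diagDifferential]
  | cons x l ih =>
    obtain ⟨hx, hl⟩ := List.forall_mem_cons.1 hl
    obtain ⟨K, rfl⟩ : ∃ K', K = K' + 1 := ⟨K - 1, by simp at hK; omega⟩
    rw [List.length_cons, add_le_add_iff_right] at hK
    -- Splitting off `x` gives `F` at `l`, expanded to order `K + 1`, and the first derivatives of
    -- `F` at `l`, expanded to order `K`. These are the two parts of `diagDifferential_add`.
    rw [hF.apply_cons hKL _ hl hx, ih hl (K + 1) (by omega) hF, List.sum_cons, add_comm x,
      Finset.sum_range_succ', Finset.sum_range_succ' (n := K + 1)]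
    simp only [ih hl K hK (hF.partialDeriv hKL _), hF.diagDifferential_add hKL _ _ _ hx]
    simp only [smul_add, Finset.sum_add_distrib, diagDifferential.eq_1]
    rw [add_right_comm]
    congr 2
    simp only [Finset.sum_mul]
    rw [Finset.sum_comm]
    refine Finset.sum_congr rfl fun k _ => ?_
    rw [smul_smul, Finset.smul_sum]
    refine Finset.sum_congr rfl fun j _ => ?_
    rw [show ((k + 1).factorial : ℚ)⁻¹ * (k + 1) = (k.factorial : ℚ)⁻¹ by
      rw [Nat.factorial_succ]; push_cast; field_simp, smul_mul_assoc, mul_comm]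

/-- A symmetric family depends only on the sum of the vectors. -/
theorem IsSymmetricFamily.eq_of_sum_eq (hKL : IsKL R) {F : ListFun R n c}
    (hF : IsSymmetricFamily F) {l l' : List (Fin n → R.obj (op c))}
    (hl : ∀ v ∈ l, IsInfinitesimal v) (hl' : ∀ v ∈ l', IsInfinitesimal v)
    (h : l.sum = l'.sum) : F c (𝟙 c) l = F c (𝟙 c) l' := by
  rw [hF.eq_sum_diagDifferential hKL l hl _ (le_max_left _ l'.length),
    hF.eq_sum_diagDifferential hKL l' hl' _ (le_max_right l.length _), h]

end SymmetricFamilies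

/-! ### Biaffine functions and a symmetry criterion for bilinear forms. -/

section BilinearForms

variable {C : Type u} [Category.{v} C] {R : Cᵒᵖ ⥤ CommAlgCat.{w} ℚ} {n : ℕ} {c : C}

theorem IsKL.cancel_two (hKL : IsKL R) (a : R.obj (op c))
    (h : ∀ (d : C) (f : d ⟶ c) (s t : R.obj (op d)), s * s = 0 → t * t = 0 →
      (R.map f.op).hom a * s * t = 0) : a = 0 := by
  refine hKL.cancel a fun d f s hs => hKL.cancel _ fun e g t ht => ?_
  rw [map_mul, ← map_comp_hom]
  exact h e (g ≫ f) _ t (by rw [← map_mul, hs, map_zero]) ht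

/-- Test on `v = p (a eᵢ + b eⱼ)` and `w = q (a eᵢ - b eⱼ)` with `a, b, p, q` of square zero. The
sum `v + w` is infinitesimal because its cross term carries `(p + q)(p - q) = p² - q² = 0`, and the
hypothesis becomes `(B j i - B i j) a b p q = 0`. -/
theorem IsKL.symm_of_sum_eq_zero (hKL : IsKL R) (B : Fin n → Fin n → R.obj (op c))
    (h : ∀ (d : C) (f : d ⟶ c) (v w : Fin n → R.obj (op d)), IsInfinitesimal v →
      IsInfinitesimal w → IsInfinitesimal (v + w) →
      ∑ i, ∑ j, (R.map f.op).hom (B i j) * v i * w j = 0) (i j : Fin n) : B i j = B j i := by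
  by_cases hij : i = j
  · rw [hij]
  rw [← sub_eq_zero]
  refine hKL.cancel_two _ fun d f a b ha hb => hKL.cancel_two _ fun e g p q hp hq => ?_
  rw [map_mul, map_mul, ← map_comp_hom, map_sub]
  have ha' : (R.map g.op).hom a * (R.map g.op).hom a = 0 := by rw [← map_mul, ha, map_zero]
  have hb' : (R.map g.op).hom b * (R.map g.op).hom b = 0 := by rw [← map_mul, hb, map_zero]
  generalize (R.map g.op).hom a = a' at *
  generalize (R.map g.op).hom b = b' at *
  set α : Fin n → R.obj (op e) := Pi.single i 1
  set β : Fin n → R.obj (op e) := Pi.single j 1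
  have hsum := h e (g ≫ f) (fun k => p * (a' * α k + b' * β k))
    (fun k => q * (a' * α k - b' * β k))
    (fun k l => by
      linear_combination (a' * α k + b' * β k) * (a' * α l + b' * β l) * hp)
    (fun k l => by
      linear_combination (a' * α k - b' * β k) * (a' * α l - b' * β l) * hq)
    (fun k l => by
      simp only [Pi.add_apply]
      linear_combination (p + q) ^ 2 * α k * α l * ha' + (p - q) ^ 2 * β k * β l * hb' +
        a' * b' * (α k * β l + β k * α l) * (hp - hq))
  have hα (b : Fin n → R.obj (op e)) : ∑ k, b k * α k = b i := by
    simpa using sum_mul_single i b 1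
  have hβ (b : Fin n → R.obj (op e)) : ∑ k, b k * β k = b j := by
    simpa using sum_mul_single j b 1
  have hinner (k : Fin n) : ∑ l, (R.map (g ≫ f).op).hom (B k l) * (p * (a' * α k + b' * β k)) *
      (q * (a' * α l - b' * β l)) =
      ((R.map (g ≫ f).op).hom (B k i) * a' - (R.map (g ≫ f).op).hom (B k j) * b') * (p * q * a') *
        α k + ((R.map (g ≫ f).op).hom (B k i) * a' - (R.map (g ≫ f).op).hom (B k j) * b') *
        (p * q * b') * β k := by
    rw [← hα fun l => (R.map (g ≫ f).op).hom (B k l), ← hβ fun l => (R.map (g ≫ f).op).hom (B k l)]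
    simp only [sub_mul, Finset.sum_mul, ← Finset.sum_sub_distrib, ← Finset.sum_add_distrib]
    refine Finset.sum_congr rfl fun l _ => ?_
    ring
  simp only [hinner] at hsum
  rw [Finset.sum_add_distrib, hα, hβ] at hsum
  linear_combination -hsum + (R.map (g ≫ f).op).hom (B i i) * p * q * ha' -
    (R.map (g ≫ f).op).hom (B j j) * p * q * hb'

/-- A natural family of functions of two first order infinitesimal vectors is biaffine. -/
theorem IsKL.exists_biaffine (hKL : IsKL R)
    (T : ∀ d : C, (d ⟶ c) → (Fin n → R.obj (op d)) → (Fin n → R.obj (op d)) → R.obj (op d))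
    (hT : ∀ (d e : C) (f : d ⟶ c) (g : e ⟶ d) (x y : Fin n → R.obj (op d)), IsInfinitesimal x →
      IsInfinitesimal y →
      T e (g ≫ f) (resVec R g x) (resVec R g y) = (R.map g.op).hom (T d f x y)) :
    ∃ (a₀ : R.obj (op c)) (a b : Fin n → R.obj (op c)) (B : Fin n → Fin n → R.obj (op c)),
      ∀ (d : C) (f : d ⟶ c) (x y : Fin n → R.obj (op d)), IsInfinitesimal x →
        IsInfinitesimal y → T d f x y = (R.map f.op).hom a₀ + ∑ j, (R.map f.op).hom (a j) * x j +
          ∑ j, (R.map f.op).hom (b j) * y j +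
          ∑ i, ∑ j, (R.map f.op).hom (B i j) * x i * y j := by
  classical
  obtain ⟨a₀, a, ha⟩ := hKL.exists_affine (fun d f x => T d f x 0) (by
    intro d e f g x hx
    rw [← hT d e f g x 0 hx isInfinitesimal_zero, resVec_zero])
  have key (d : C) (f : d ⟶ c) (x : Fin n → R.obj (op d)) (hx : IsInfinitesimal x) :
      ∃ t : Fin n → R.obj (op d), ∀ (e : C) (g : e ⟶ d) (y : Fin n → R.obj (op e)),
        IsInfinitesimal y → T e (g ≫ f) (resVec R g x) y =
          T e (g ≫ f) (resVec R g x) 0 + ∑ j, (R.map g.op).hom (t j) * y j := by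
    obtain ⟨t₀, t, ht⟩ := hKL.exists_affine (fun e g y => T e (g ≫ f) (resVec R g x) y) (by
      intro e e' g h y hy
      rw [← hT _ _ _ h _ _ (hx.res g) hy, resVec_comp, Category.assoc])
    refine ⟨t, fun e g y hy => ?_⟩
    rw [ht e g y hy, ht e g 0 isInfinitesimal_zero]
    simp
  choose t ht using key
  -- The coefficients `t` of `y` are unique, hence natural in `x`, hence themselves affine in `x`.
  have hres (j : Fin n) : ∀ (d e : C) (f : d ⟶ c) (g : e ⟶ d) (x : Fin n → R.obj (op d))
      (hx : IsInfinitesimal x), t e (g ≫ f) (resVec R g x) (hx.res g) j =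
        (R.map g.op).hom (t d f x hx j) := by
    intro d e f g x hx
    rw [← sub_eq_zero]
    refine congrFun (hKL.cancel_sum (fun j => t e (g ≫ f) (resVec R g x) (hx.res g) j -
      (R.map g.op).hom (t d f x hx j)) fun e' h y hy => ?_) j
    have h1 := ht e (g ≫ f) (resVec R g x) (hx.res g) e' h y hy
    have h2 := ht d f x hx e' (h ≫ g) y hy
    simp only [Category.assoc, resVec_comp, map_comp_hom] at h1 h2
    simp only [map_sub, sub_mul, Finset.sum_sub_distrib]
    linear_combination h2 - h1
  have hB (j : Fin n) := hKL.exists_affine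
    (fun d f x => if hx : IsInfinitesimal x then t d f x hx j else 0) (by
      intro d e f g x hx
      rw [dif_pos hx, dif_pos (hx.res g), hres])
  choose b B hB using hB
  refine ⟨a₀, a, b, fun i j => B j i, fun d f x y hx hy => ?_⟩
  have h1 := ht d f x hx d (𝟙 d) y hy
  simp only [Category.id_comp, resVec_id, map_id_hom] at h1
  rw [h1, ha d f x hx, add_assoc ((R.map f.op).hom a₀ + _)]
  congr 1
  rw [Finset.sum_comm, ← Finset.sum_add_distrib]
  refine Finset.sum_congr rfl fun j _ => ?_
  have h2 := hB j d f x hx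
  rw [dif_pos hx] at h2
  rw [h2, add_mul, Finset.sum_mul]

end BilinearForms

/-! ### Two-step transport in a chart. -/

section LocalConnections

variable {C : Type u} [Category.{v} C] {R : Cᵒᵖ ⥤ CommAlgCat.{w} ℚ} {n : ℕ}

/-- A symmetric flat affine connection on a formally open subobject `dom` of `Rⁿ`. -/
structure IsLocalConnection (R : Cᵒᵖ ⥤ CommAlgCat.{w} ℚ) (dom : ∀ c : C, Set (Fin n → R.obj (op c)))
    (par : ∀ c : C, (Fin n → R.obj (op c)) → (Fin n → R.obj (op c)) → (Fin n → R.obj (op c)) →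
      (Fin n → R.obj (op c))) : Prop where
  dom_res : ∀ {c d : C} (f : d ⟶ c), ∀ x ∈ dom c, resVec R f x ∈ dom d
  dom_open : ∀ {c : C}, ∀ x ∈ dom c, ∀ y, VecNbr x y → y ∈ dom c
  par_res : ∀ {c d : C} (f : d ⟶ c), ∀ x ∈ dom c, ∀ y z, VecNbr x y → VecNbr x z →
    resVec R f (par c x y z) = par d (resVec R f x) (resVec R f y) (resVec R f z)
  nbr_left : ∀ {c : C}, ∀ x ∈ dom c, ∀ y z, VecNbr x y → VecNbr x z → VecNbr y (par c x y z)
  unit_left : ∀ {c : C}, ∀ x ∈ dom c, ∀ z, VecNbr x z → par c x x z = z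
  symm : ∀ {c : C}, ∀ x ∈ dom c, ∀ y z, VecNbr x y → VecNbr x z → par c x y z = par c x z y
  flat : ∀ {c : C}, ∀ x ∈ dom c, ∀ y z, VecNbr x y → VecNbr y z → VecNbr x z →
    ∀ a, VecNbr x a → par c y z (par c x y a) = par c x z a

namespace IsLocalConnection

variable {dom : ∀ c : C, Set (Fin n → R.obj (op c))}
  {par : ∀ c : C, (Fin n → R.obj (op c)) → (Fin n → R.obj (op c)) → (Fin n → R.obj (op c)) →
      (Fin n → R.obj (op c))} {c : C}

/-- Transport along two infinitesimal steps depends only on the end points. -/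
theorem par_par_eq (hl : IsLocalConnection R dom par) (hKL : IsKL R)
    {x y y' w z : Fin n → R.obj (op c)} (hx : x ∈ dom c) (hxy : VecNbr x y) (hyw : VecNbr y w)
    (hxy' : VecNbr x y') (hyw' : VecNbr y' w) (hxz : VecNbr x z) :
    par c y w (par c x y z) = par c y' w (par c x y' z) := by
  funext k
  -- `P u v` is the transport of `z` along `x`, `x + u`, `x + u + v`, taken at all stages over `c`
  -- so that the Kock–Lawvere axiom applies.
  let P (d : C) (f : d ⟶ c) (u v : Fin n → R.obj (op d)) : Fin n → R.obj (op d) :=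
    par d (resVec R f x + u) (resVec R f x + u + v)
      (par d (resVec R f x) (resVec R f x + u) (resVec R f z))
  have hP (d e : C) (f : d ⟶ c) (g : e ⟶ d) (u v : Fin n → R.obj (op d))
      (hu : IsInfinitesimal u) (hv : IsInfinitesimal v) :
      P e (g ≫ f) (resVec R g u) (resVec R g v) = resVec R g (P d f u v) := by
    have hxf := hl.dom_res f x hx
    have hn := vecNbr_add (resVec R f x) hu
    simp only [P]
    rw [hl.par_res g _ (hl.dom_open _ hxf _ hn) _ _ (vecNbr_add _ hv)
        (hl.nbr_left _ hxf _ _ hn (hxz.res f)),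
      hl.par_res g _ hxf _ _ hn (hxz.res f)]
    simp only [resVec_add, resVec_comp]
  obtain ⟨a₀, a, b, B, h⟩ := hKL.exists_biaffine (c := c) (fun d f u v => P d f u v k)
    (fun d e f g u v hu hv => congrFun (hP d e f g u v hu hv) k)
  have hP0 (d : C) (f : d ⟶ c) (u : Fin n → R.obj (op d)) (hu : IsInfinitesimal u) :
      P d f u 0 = par d (resVec R f x) (resVec R f x + u) (resVec R f z) := by
    have hxf := hl.dom_res f x hx
    have hn := vecNbr_add (resVec R f x) hu
    simp only [P]
    rw [add_zero, hl.unit_left _ (hl.dom_open _ hxf _ hn) _ (hl.nbr_left _ hxf _ _ hn (hxz.res f))]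
  have h0P (d : C) (f : d ⟶ c) (u : Fin n → R.obj (op d)) (hu : IsInfinitesimal u) :
      P d f 0 u = P d f u 0 := by
    rw [hP0 d f u hu]
    simp only [P]
    rw [add_zero, hl.unit_left _ (hl.dom_res f x hx) _ (hxz.res f)]
  -- A trivial step may come first or last, so the two linear parts agree on infinitesimal vectors.
  have hab (d : C) (f : d ⟶ c) (u : Fin n → R.obj (op d)) (hu : IsInfinitesimal u) :
      ∑ j, (R.map f.op).hom (b j) * u j = ∑ j, (R.map f.op).hom (a j) * u j := by
    have h1 := h d f 0 u isInfinitesimal_zero hu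
    have h2 := h d f u 0 hu isInfinitesimal_zero
    rw [h0P d f u hu, h2] at h1
    simp only [Pi.zero_apply, mul_zero, zero_mul, Finset.sum_const_zero, add_zero] at h1
    linear_combination -h1
  -- If `u + v` is infinitesimal, flatness replaces the two steps by one, and the bilinear term must
  -- vanish.
  have hB := hKL.symm_of_sum_eq_zero B (by
    intro d f u v hu hv huv
    have h1 := h d f u v hu hv
    have h2 := h d f (u + v) 0 huv isInfinitesimal_zero
    have hxf := hl.dom_res f x hx
    have h3 : P d f u v = P d f (u + v) 0 := by
      rw [hP0 d f _ huv, ← add_assoc]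
      refine hl.flat _ hxf _ _ (vecNbr_add _ hu) (vecNbr_add _ hv) ?_ _ (hxz.res f)
      rw [add_assoc]
      exact vecNbr_add _ huv
    rw [h3, h2, hab d f v hv] at h1
    simp only [Pi.zero_apply, mul_zero, Finset.sum_const_zero, add_zero, Pi.add_apply, mul_add,
      Finset.sum_add_distrib] at h1
    linear_combination -h1)
  -- The intermediate point disappears: by symmetry `B(w - x, w - x)` is twice the mixed term, the
  -- pure squares of the two steps being zero.
  have hexp (u : Fin n → R.obj (op c)) (hu : VecNbr x u) (huw : VecNbr u w) :
      par c u w (par c x u z) k = a₀ + ∑ j, a j * (w - x) j +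
        (2 : ℚ)⁻¹ • ∑ i, ∑ j, B i j * (w - x) i * (w - x) j := by
    have h1 := h c (𝟙 c) (u - x) (w - u) hu huw
    rw [hab c (𝟙 c) _ (vecNbr_iff.1 huw)] at h1
    simp only [P, resVec_id, map_id_hom] at h1
    rw [add_sub_cancel, add_sub_cancel] at h1
    rw [h1, add_assoc a₀, ← Finset.sum_add_distrib]
    congr 2
    · exact Finset.sum_congr rfl fun j _ => by simp only [Pi.sub_apply]; ring
    · have hsw : ∑ i, ∑ j, B i j * (u - x) i * (w - u) j =
          ∑ i, ∑ j, B i j * (w - u) i * (u - x) j := by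
        rw [Finset.sum_comm]
        refine Finset.sum_congr rfl fun i _ => Finset.sum_congr rfl fun j _ => ?_
        rw [hB i j]
        ring
      have htwo : ∑ i, ∑ j, B i j * (w - x) i * (w - x) j =
          (2 : ℚ) • ∑ i, ∑ j, B i j * (u - x) i * (w - u) j := by
        rw [two_smul]
        nth_rewrite 2 [hsw]
        simp only [← Finset.sum_add_distrib]
        refine Finset.sum_congr rfl fun i _ => Finset.sum_congr rfl fun j _ => ?_
        have h1 : (u i - x i) * (u j - x j) = 0 := hu i j
        have h2 : (w i - u i) * (w j - u j) = 0 := huw i j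
        simp only [Pi.sub_apply]
        linear_combination B i j * h1 + B i j * h2
      rw [htwo, smul_smul]
      norm_num
  rw [hexp y hxy hyw, hexp y' hxy' hyw']

end IsLocalConnection

end LocalConnections

/-! ### Grids as iterated transport of rows. -/

section Sweeps

variable {X : Type*}

theorem transport_congr (par : X → X → X → X) {m : ℕ} {y y' : ℕ → X} (h : ∀ j ≤ m, y j = y' j)
    (b : X) : ∀ j ≤ m, transport par y b j = transport par y' b j
  | 0, _ => rfl
  | j + 1, hj => by
    rw [transport, transport, h j (by omega), h (j + 1) hj,
      transport_congr par h b j (by omega)]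

/-- The last row obtained by transporting the row `y` successively along the displacements of its
initial point given by a list of vectors. -/
def sweep [Add X] (par : X → X → X → X) (y : ℕ → X) : List X → ℕ → X
  | [] => y
  | v :: l => sweep par (transport par y (y 0 + v)) l

theorem sweep_append [Add X] (par : X → X → X → X) (y : ℕ → X) (l : List X) (v : X) :
    sweep par y (l ++ [v]) = transport par (sweep par y l) (sweep par y l 0 + v) := by
  induction l generalizing y with
  | nil => rfl
  | cons w l ih => exact ih _

theorem sweep_congr [Add X] (par : X → X → X → X) {m : ℕ} (l : List X) {y y' : ℕ → X}
    (h : ∀ j ≤ m, y j = y' j) : ∀ j ≤ m, sweep par y l j = sweep par y' l j := by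
  induction l generalizing y y' with
  | nil => exact h
  | cons v l ih =>
    rw [sweep, sweep, h 0 (Nat.zero_le m)]
    exact ih (transport_congr par h _)

/-- This recasts the vertical path as its list of displacements, on which permutation makes sense.
-/
theorem sweep_diff_eq_grid [AddCommGroup X] (par : X → X → X → X) {y z : ℕ → X}
    (h : y 0 = z 0) (k : ℕ) :
    sweep par y ((List.range k).map fun i => z (i + 1) - z i) = grid par y z k := by
  induction k with
  | zero => rfl
  | succ k ih =>
    rw [List.range_succ, List.map_append, List.map_singleton, sweep_append, ih,
      grid_zero_right par y z h, add_sub_cancel, grid]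

theorem sum_range_map_diff [AddCommGroup X] (z : ℕ → X) (k : ℕ) :
    ((List.range k).map fun i => z (i + 1) - z i).sum = z k - z 0 := by
  induction k with
  | zero => simp
  | succ k ih => simp [List.range_succ, ih]

end Sweeps

/-! ### Independence of the vertical path in a chart. -/

section LocalConnections

variable {C : Type u} [Category.{v} C] {R : Cᵒᵖ ⥤ CommAlgCat.{w} ℚ} {n : ℕ}

namespace IsLocalConnection

variable {dom : ∀ c : C, Set (Fin n → R.obj (op c))}
  {par : ∀ c : C, (Fin n → R.obj (op c)) → (Fin n → R.obj (op c)) → (Fin n → R.obj (op c)) →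
      (Fin n → R.obj (op c))} {c : C} {m : ℕ} {y z z' : ℕ → Fin n → R.obj (op c)}
  {b : Fin n → R.obj (op c)}

theorem path_mem (hl : IsLocalConnection R dom par) (h0 : y 0 ∈ dom c) (hy : IsPath VecNbr m y) :
    ∀ j ≤ m, y j ∈ dom c
  | 0, _ => h0
  | j + 1, hj => hl.dom_open _ (hl.path_mem h0 hy j (by omega)) _ (hy j hj)

theorem transport_nbr (hl : IsLocalConnection R dom par) (h0 : y 0 ∈ dom c)
    (hy : IsPath VecNbr m y) (hb : VecNbr (y 0) b) :
    ∀ j ≤ m, VecNbr (y j) (transport (par c) y b j)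
  | 0, _ => hb
  | j + 1, hj =>
    hl.nbr_left _ (hl.path_mem h0 hy j (by omega)) _ _ (hy j hj)
      (hl.transport_nbr h0 hy hb j (by omega))

theorem transport_isPath (hl : IsLocalConnection R dom par) (h0 : y 0 ∈ dom c)
    (hy : IsPath VecNbr m y) (hb : VecNbr (y 0) b) :
    IsPath VecNbr m (transport (par c) y b) := fun j hj => by
  have hn := hl.transport_nbr h0 hy hb j hj.le
  have hm := hl.path_mem h0 hy j hj.le
  rw [transport, hl.symm _ hm _ _ (hy j hj) hn]
  exact hl.nbr_left _ hm _ _ hn (hy j hj)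

theorem resVec_transport (hl : IsLocalConnection R dom par) (h0 : y 0 ∈ dom c)
    (hy : IsPath VecNbr m y) (hb : VecNbr (y 0) b) {d : C} (f : d ⟶ c) :
    ∀ j ≤ m, resVec R f (transport (par c) y b j) =
      transport (par d) (fun i => resVec R f (y i)) (resVec R f b) j
  | 0, _ => rfl
  | j + 1, hj => by
    rw [transport, hl.par_res f _ (hl.path_mem h0 hy j (by omega)) _ _ (hy j hj)
      (hl.transport_nbr h0 hy hb j (by omega)), hl.resVec_transport h0 hy hb f j (by omega),
      transport]

theorem transport_self (hl : IsLocalConnection R dom par) (h0 : y 0 ∈ dom c)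
    (hy : IsPath VecNbr m y) : ∀ j ≤ m, transport (par c) y (y 0) j = y j
  | 0, _ => rfl
  | j + 1, hj => by
    have hm := hl.path_mem h0 hy j (by omega)
    rw [transport, hl.transport_self h0 hy j (by omega),
      hl.symm _ hm _ _ (hy j hj) (VecNbr.refl _), hl.unit_left _ hm _ (hy j hj)]

/-- By symmetry of the connection, each new point is the transport of `y (j + 1)` along the column
over `y j`. The two columns over `y j` have equal ends by induction, so `par_par_eq` makes the
middle row irrelevant. -/
theorem transport_transport_eq (hl : IsLocalConnection R dom par) (hKL : IsKL R)
    (h0 : y 0 ∈ dom c) (hy : IsPath VecNbr m y) {b' e : Fin n → R.obj (op c)}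
    (hb : VecNbr (y 0) b) (hb' : VecNbr (y 0) b') (hbe : VecNbr b e) (hbe' : VecNbr b' e) :
    ∀ j ≤ m, transport (par c) (transport (par c) y b) e j =
      transport (par c) (transport (par c) y b') e j
  | 0, _ => rfl
  | j + 1, hj => by
    have hm := hl.path_mem h0 hy j (by omega)
    have key : ∀ a, VecNbr (y 0) a → VecNbr a e →
        transport (par c) (transport (par c) y a) e (j + 1) =
          par c (transport (par c) y a j) (transport (par c) (transport (par c) y a) e j)
            (par c (y j) (transport (par c) y a j) (y (j + 1))) := by
      intro a ha hae
      have hp := hl.transport_isPath h0 hy ha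
      have h0' := hl.dom_open _ h0 _ ha
      rw [transport, hl.symm _ (hl.path_mem h0' hp j (by omega)) _ _ (hp j hj)
        (hl.transport_nbr h0' hp hae j (by omega)), transport,
        hl.symm _ hm _ _ (hy j hj) (hl.transport_nbr h0 hy ha j (by omega))]
    have hn := hl.transport_nbr (hl.dom_open _ h0 _ hb) (hl.transport_isPath h0 hy hb) hbe j
      (by omega)
    have hn' := hl.transport_nbr (hl.dom_open _ h0 _ hb') (hl.transport_isPath h0 hy hb') hbe' j
      (by omega)
    have ih := hl.transport_transport_eq hKL h0 hy hb hb' hbe hbe' j (by omega)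
    rw [← ih] at hn'
    rw [key b hb hbe, key b' hb' hbe', ← ih]
    exact hl.par_par_eq hKL hm (hl.transport_nbr h0 hy hb j (by omega)) hn
      (hl.transport_nbr h0 hy hb' j (by omega)) hn' (hy j hj)

theorem resVec_sweep (hl : IsLocalConnection R dom par) {d : C} (f : d ⟶ c)
    (l : List (Fin n → R.obj (op c))) (hv : ∀ v ∈ l, IsInfinitesimal v)
    {y : ℕ → Fin n → R.obj (op c)} (h0 : y 0 ∈ dom c)
    (hy : IsPath VecNbr m y) : ∀ j ≤ m, resVec R f (sweep (par c) y l j) =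
      sweep (par d) (fun i => resVec R f (y i)) (l.map (resVec R f)) j := by
  induction l generalizing y with
  | nil => exact fun j _ => rfl
  | cons v l ih =>
    intro j hj
    obtain ⟨hv, hvl⟩ := List.forall_mem_cons.1 hv
    have hb := vecNbr_add (y 0) hv
    rw [sweep, ih hvl (hl.dom_open _ h0 _ hb) (hl.transport_isPath h0 hy hb) j hj, List.map_cons,
      sweep]
    refine sweep_congr _ _ (fun i hi => ?_) j hj
    rw [hl.resVec_transport h0 hy hb f i hi, resVec_add]

theorem sweep_perm (hl : IsLocalConnection R dom par) (hKL : IsKL R)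
    {l l' : List (Fin n → R.obj (op c))} (h : l.Perm l') :
    ∀ (_ : ∀ v ∈ l, IsInfinitesimal v)
    {y : ℕ → Fin n → R.obj (op c)} (_ : y 0 ∈ dom c)
    (_ : IsPath VecNbr m y), ∀ j ≤ m, sweep (par c) y l j = sweep (par c) y l' j := by
  induction h with
  | nil => intros; rfl
  | cons v h ih =>
    intro hv y h0 hy
    obtain ⟨hv, hvl⟩ := List.forall_mem_cons.1 hv
    have hb := vecNbr_add (y 0) hv
    exact ih hvl (hl.dom_open _ h0 _ hb) (hl.transport_isPath h0 hy hb)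
  | swap a b l =>
    intro hv y h0 hy
    obtain ⟨hb, hv⟩ := List.forall_mem_cons.1 hv
    obtain ⟨ha, hv⟩ := List.forall_mem_cons.1 hv
    refine sweep_congr (par c) l fun j hj => ?_
    simp only [transport]
    -- Both orders lead from `y 0` to `y 0 + a + b`, through `y 0 + b` or `y 0 + a`.
    rw [add_right_comm (y 0) a b]
    refine hl.transport_transport_eq hKL h0 hy (vecNbr_add _ hb) (vecNbr_add _ ha)
      (vecNbr_add _ ha) ?_ j hj
    rw [add_right_comm]
    exact vecNbr_add _ hb
  | trans h _ ih ih' =>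
    intro hv y h0 hy j hj
    rw [ih hv h0 hy j hj, ih' (fun v hv' => hv v (h.mem_iff.2 hv')) h0 hy j hj]

/-- Each coordinate of the corner is treated as a function of the vertical displacements; a zero
displacement reproduces the row. -/
theorem isSymmetricFamily_sweep (hl : IsLocalConnection R dom par) (hKL : IsKL R)
    (h0 : y 0 ∈ dom c) (hy : IsPath VecNbr m y) (k : Fin n) :
    IsSymmetricFamily (fun d (f : d ⟶ c) l => sweep (par d) (fun i => resVec R f (y i)) l m k) := by
  have hyf {d : C} (f : d ⟶ c) : IsPath VecNbr m (fun i => resVec R f (y i)) :=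
    fun j hj => (hy j hj).res f
  refine ⟨fun d e f g l hv => ?_, fun d f l l' hv h => ?_, fun d f l _ => ?_⟩
  · have := hl.resVec_sweep g l hv (hl.dom_res f _ h0) (hyf f) m le_rfl
    simp only [resVec_comp, ← this]
    rfl
  · exact congrFun (hl.sweep_perm hKL h hv (hl.dom_res f _ h0) (hyf f) m le_rfl) k
  · refine congrFun (sweep_congr (par d) l (fun j hj => ?_) m le_rfl) k
    rw [add_zero, hl.transport_self (hl.dom_res f _ h0) (hyf f) j hj]

/-- The codomain of a grid depends only on the end points of the vertical path. -/
theorem grid_eq (hl : IsLocalConnection R dom par) (hKL : IsKL R)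
    (h0 : y 0 ∈ dom c) (hy : IsPath VecNbr m y) {k k' : ℕ} (hz : IsPath VecNbr k z)
    (hz' : IsPath VecNbr k' z') (hz0 : y 0 = z 0) (hz0' : y 0 = z' 0) (hend : z k = z' k') :
    grid (par c) y z k m = grid (par c) y z' k' m := by
  have hinf {k : ℕ} {z : ℕ → Fin n → R.obj (op c)} (hz : IsPath VecNbr k z) :
      ∀ v ∈ (List.range k).map (fun i => z (i + 1) - z i), IsInfinitesimal v := by
    intro v hv
    obtain ⟨i, hi, rfl⟩ := List.mem_map.1 hv
    exact hz i (List.mem_range.1 hi)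
  rw [← sweep_diff_eq_grid _ hz0, ← sweep_diff_eq_grid _ hz0']
  funext i
  have := (hl.isSymmetricFamily_sweep hKL h0 hy i).eq_of_sum_eq hKL (hinf hz) (hinf hz')
    (by rw [sum_range_map_diff, sum_range_map_diff, hend, ← hz0, ← hz0'])
  simpa only [resVec_id] using this

end IsLocalConnection

end LocalConnections

/-! ### Grids on a general object: neighbours, naturality, transposition. -/

section GridsOfConnections

variable {C : Type u} [Category.{v} C] {M : Cᵒᵖ ⥤ Type t} {r : StageRel M}

namespace AffineConnection

variable (l : AffineConnection M r) {c : C} {m k : ℕ} {y z : ℕ → M.obj (op c)} {b : M.obj (op c)}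

theorem transport_rel (hr : ∀ (c : C) (x y : M.obj (op c)), r c x y → r c y x)
    (hy : IsPath (r c) m y) (hb : r c (y 0) b) :
    ∀ j ≤ m, r c (y j) (transport (l.par c) y b j)
  | 0, _ => hb
  | j + 1, hj =>
    hr _ _ _ (l.book_left _ _ _ (hy j hj) (transport_rel hr hy hb j (by omega)))

theorem transport_isPath (hr : ∀ (c : C) (x y : M.obj (op c)), r c x y → r c y x)
    (hy : IsPath (r c) m y) (hb : r c (y 0) b) :
    IsPath (r c) m (transport (l.par c) y b) := fun j hj =>
  hr _ _ _ (l.book_right _ _ _ (hy j hj) (l.transport_rel hr hy hb j hj.le))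

theorem map_transport (hr : ∀ (c : C) (x y : M.obj (op c)), r c x y → r c y x)
    (hy : IsPath (r c) m y) (hb : r c (y 0) b) {d : C} (f : d ⟶ c) :
    ∀ j ≤ m, M.map f.op (transport (l.par c) y b j) =
      transport (l.par d) (fun i => M.map f.op (y i)) (M.map f.op b) j
  | 0, _ => rfl
  | j + 1, hj => by
    rw [transport, l.par_res f _ _ _ (hy j hj) (l.transport_rel hr hy hb j (by omega)),
      map_transport hr hy hb f j (by omega), transport]

theorem grid_isPath (hr : ∀ (c : C) (x y : M.obj (op c)), r c x y → r c y x)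
    (hy : IsPath (r c) m y) (hz : IsPath (r c) k z) (h0 : y 0 = z 0) :
    ∀ i ≤ k, IsPath (r c) m (grid (l.par c) y z i)
  | 0, _ => hy
  | i + 1, hi => l.transport_isPath hr (grid_isPath hr hy hz h0 i (by omega)) (by
      rw [grid_zero_right _ _ _ h0]
      exact hz i hi)

theorem grid_rel_succ (hr : ∀ (c : C) (x y : M.obj (op c)), r c x y → r c y x)
    (hy : IsPath (r c) m y) (hz : IsPath (r c) k z) (h0 : y 0 = z 0) {i j : ℕ} (hi : i < k)
    (hj : j ≤ m) : r c (grid (l.par c) y z i j) (grid (l.par c) y z (i + 1) j) :=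
  l.transport_rel hr (l.grid_isPath hr hy hz h0 i hi.le)
    (by rw [grid_zero_right _ _ _ h0]; exact hz i hi) j hj

theorem map_grid (hr : ∀ (c : C) (x y : M.obj (op c)), r c x y → r c y x)
    (hy : IsPath (r c) m y) (hz : IsPath (r c) k z) (h0 : y 0 = z 0) {d : C} (f : d ⟶ c) :
    ∀ i ≤ k, ∀ j ≤ m, M.map f.op (grid (l.par c) y z i j) =
      grid (l.par d) (fun j => M.map f.op (y j)) (fun i => M.map f.op (z i)) i j
  | 0, _ => fun _ _ => rfl
  | i + 1, hi => fun j hj => by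
    rw [grid, l.map_transport hr (l.grid_isPath hr hy hz h0 i (by omega))
      (by rw [grid_zero_right _ _ _ h0]; exact hz i hi) f j hj, grid]
    exact transport_congr _ (map_grid hr hy hz h0 f i (by omega)) _ j hj

theorem grid_symm (hr : ∀ (c : C) (x y : M.obj (op c)), r c x y → r c y x) (hl : l.IsSymmetric)
    (hy : IsPath (r c) m y) (hz : IsPath (r c) k z) (h0 : y 0 = z 0) :
    ∀ i ≤ k, ∀ j ≤ m, grid (l.par c) y z i j = grid (l.par c) z y j i
  | 0, _ => fun j _ => (grid_zero_right _ _ _ h0.symm j).symm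
  | i + 1, hi => fun j hj => by
    induction j with
    | zero => exact grid_zero_right _ _ _ h0 _
    | succ j ih =>
      rw [grid_succ_succ, grid_succ_succ, ← ih (by omega),
        ← grid_symm hr hl hy hz h0 i (by omega) j (by omega),
        ← grid_symm hr hl hy hz h0 i (by omega) (j + 1) hj]
      exact hl _ _ _ _ (l.grid_isPath hr hy hz h0 i (by omega) j hj)
        (l.grid_rel_succ hr hy hz h0 hi (by omega))

end AffineConnection

theorem IsPath.map {c d : C} (hres : ∀ {c d : C} (f : d ⟶ c) (x y : M.obj (op c)), r c x y →
    r d (M.map f.op x) (M.map f.op y)) (f : d ⟶ c) {m : ℕ} {y : ℕ → M.obj (op c)}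
    (hy : IsPath (r c) m y) : IsPath (r d) m (fun j => M.map f.op (y j)) :=
  fun j hj => hres f _ _ (hy j hj)

end GridsOfConnections

/-! ### Passage between the manifold and its charts. -/

section Charts

variable {C : Type u} [Category.{v} C] {J : GrothendieckTopology C}
  {R : Cᵒᵖ ⥤ CommAlgCat.{w} ℚ} {M : Cᵒᵖ ⥤ Type t}

namespace FormalAtlas

variable (𝒜 : FormalAtlas.{v, u, w, t, s} J R M)

theorem nbr_symm (c : C) (x y : M.obj (op c)) (h : 𝒜.nbr c x y) : 𝒜.nbr c y x := by
  obtain ⟨S, hS, h⟩ := h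
  refine ⟨S, hS, fun d f hf => ?_⟩
  obtain ⟨i, a, ha, b, hb, hax, hby, hab⟩ := h d f hf
  exact ⟨i, b, hb, a, ha, hby, hax, hab.symm⟩

theorem nbr_res {c d : C} (f : d ⟶ c) (x y : M.obj (op c)) (h : 𝒜.nbr c x y) :
    𝒜.nbr d (M.map f.op x) (M.map f.op y) := by
  obtain ⟨S, hS, h⟩ := h
  refine ⟨S.pullback f, J.pullback_stable f hS, fun e g hg => ?_⟩
  have := h e (g ≫ f) hg
  simpa using this

theorem nbr_of_vecNbr (i : 𝒜.ι) {c : C} {x y : Fin (𝒜.dim i) → R.obj (op c)}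
    (hx : x ∈ 𝒜.dom i c) (hxy : VecNbr x y) : 𝒜.nbr c (𝒜.ψ i c x) (𝒜.ψ i c y) := by
  have hy := 𝒜.dom_open i c x hx y hxy
  exact ⟨⊤, J.top_mem c, fun d f _ => ⟨i, _, 𝒜.dom_res i f x hx, _, 𝒜.dom_res i f y hy,
    𝒜.ψ_res i f x hx, 𝒜.ψ_res i f y hy, hxy.res f⟩⟩

open Classical in
/-- The coordinates of a point of `M` in a chart (and `0` outside of the chart). -/
noncomputable def coord (i : 𝒜.ι) (c : C) (m : M.obj (op c)) : Fin (𝒜.dim i) → R.obj (op c) :=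
  if h : ∃ x ∈ 𝒜.dom i c, 𝒜.ψ i c x = m then h.choose else 0

theorem coord_eq (i : 𝒜.ι) {c : C} {x : Fin (𝒜.dim i) → R.obj (op c)} (hx : x ∈ 𝒜.dom i c)
    {m : M.obj (op c)} (h : 𝒜.ψ i c x = m) : 𝒜.coord i c m = x := by
  have h' : ∃ x ∈ 𝒜.dom i c, 𝒜.ψ i c x = m := ⟨x, hx, h⟩
  rw [coord, dif_pos h']
  exact 𝒜.ψ_inj i c h'.choose_spec.1 hx (h'.choose_spec.2.trans h.symm)

/-- Transition functions between charts preserve first order neighbours. -/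
theorem vecNbr_of_vecNbr (hKL : IsKL R) (i j : 𝒜.ι) {c : C}
    {x y : Fin (𝒜.dim i) → R.obj (op c)} {x' y' : Fin (𝒜.dim j) → R.obj (op c)}
    (hx : x ∈ 𝒜.dom i c) (hy : y ∈ 𝒜.dom i c) (hx' : x' ∈ 𝒜.dom j c)
    (hxx' : 𝒜.ψ i c x = 𝒜.ψ j c x') (hyy' : 𝒜.ψ i c y = 𝒜.ψ j c y')
    (h : VecNbr x' y') : VecNbr x y := by
  have hex (d : C) (f : d ⟶ c) (v : Fin (𝒜.dim j) → R.obj (op d)) (hv : IsInfinitesimal v) :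
      ∃ u ∈ 𝒜.dom i d, 𝒜.ψ i d u = 𝒜.ψ j d (resVec R f x' + v) := by
    have hxf := 𝒜.dom_res j f x' hx'
    refine 𝒜.ψ_open i j d _ (𝒜.dom_res i f x hx) _ hxf _
      (𝒜.dom_open j d _ hxf _ (vecNbr_add _ hv)) ?_ (vecNbr_add _ hv)
    rw [𝒜.ψ_res i f x hx, 𝒜.ψ_res j f x' hx', hxx']
  -- The transition function is affine on the neighbours of `x'`, so `y - x` is linear in `y' - x'`
  -- and its products vanish.
  have key (k : Fin (𝒜.dim i)) := hKL.exists_affine (c := c)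
    (fun d f v => 𝒜.coord i d (𝒜.ψ j d (resVec R f x' + v)) k) (by
      intro d e f g v hv
      obtain ⟨u, hu, huv⟩ := hex d f v hv
      have hn := 𝒜.dom_open j d _ (𝒜.dom_res j f x' hx') _ (vecNbr_add _ hv)
      rw [𝒜.coord_eq i hu huv, 𝒜.coord_eq i (𝒜.dom_res i g u hu)]
      · rfl
      · rw [𝒜.ψ_res i g u hu, huv, ← 𝒜.ψ_res j g _ hn, resVec_add, resVec_comp])
  have hval (k : Fin (𝒜.dim i)) : ∃ a : Fin (𝒜.dim j) → R.obj (op c),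
      y k - x k = ∑ p, a p * (y' - x') p := by
    obtain ⟨a₀, a, ha⟩ := key k
    refine ⟨a, ?_⟩
    have h1 := ha c (𝟙 c) 0 isInfinitesimal_zero
    have h2 := ha c (𝟙 c) (y' - x') h
    rw [resVec_id, add_zero, 𝒜.coord_eq i hx hxx'] at h1
    rw [resVec_id, add_sub_cancel, 𝒜.coord_eq i hy hyy'] at h2
    simp only [map_id_hom, Pi.zero_apply, mul_zero, Finset.sum_const_zero, add_zero] at h1 h2
    rw [h1, h2, add_sub_cancel_left]
  intro k k'
  obtain ⟨a, ha⟩ := hval k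
  obtain ⟨b, hb⟩ := hval k'
  rw [ha, hb]
  exact IsInfinitesimal.sum_mul_sum (vecNbr_iff.1 h) a b

/-- The image of a chart is closed under first order neighbours, and neighbours in `M` of a point
of a chart have neighbouring coordinates in that chart. -/
theorem exists_vecNbr_of_nbr (hR : Presieve.IsSheaf J (R ⋙ forget (CommAlgCat.{w} ℚ)))
    (hKL : IsKL R) (hM : Presieve.IsSheaf J M) (i : 𝒜.ι) {c : C}
    {x : Fin (𝒜.dim i) → R.obj (op c)} (hx : x ∈ 𝒜.dom i c) {m : M.obj (op c)}
    (h : 𝒜.nbr c (𝒜.ψ i c x) m) :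
    ∃ y ∈ 𝒜.dom i c, 𝒜.ψ i c y = m ∧ VecNbr x y := by
  obtain ⟨S, hS, h⟩ := h
  have hloc : ∀ (d : C) (f : d ⟶ c), S f → ∃ y ∈ 𝒜.dom i d, 𝒜.ψ i d y = M.map f.op m ∧
      VecNbr (resVec R f x) y := by
    intro d f hf
    obtain ⟨j, x', hx', y', hy', hxx', hyy', hn⟩ := h d f hf
    rw [← 𝒜.ψ_res i f x hx] at hxx'
    have hxf := 𝒜.dom_res i f x hx
    obtain ⟨y, hy, hyy⟩ := 𝒜.ψ_open i j d _ hxf x' hx' y' hy' hxx'.symm hn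
    exact ⟨y, hy, hyy.trans hyy', 𝒜.vecNbr_of_vecNbr hKL i j hxf hy hx' hxx'.symm hyy hn⟩
  choose Y hY hψ hn using hloc
  -- Injectivity of the chart makes the local coordinates compatible; they glue because `R` is a
  -- sheaf.
  have hglue (k : Fin (𝒜.dim i)) : ∃ a : R.obj (op c), ∀ (d : C) (f : d ⟶ c) (hf : S f),
      (R.map f.op).hom a = Y d f hf k := by
    obtain ⟨a, ha, -⟩ := hR S hS (fun d f hf => Y d f hf k) ((Presieve.compatible_iff_sieveCompatible _).2 (by
      intro d e f g hf
      have : Y e (g ≫ f) (S.downward_closed hf g) = resVec R g (Y d f hf) := by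
        refine 𝒜.ψ_inj i e (hY _ _ _) (𝒜.dom_res i g _ (hY _ _ _)) ?_
        rw [hψ, 𝒜.ψ_res i g _ (hY _ _ _), hψ]
        simp
      exact congrFun this k))
    exact ⟨a, ha⟩
  choose y hy using hglue
  have hyY (d : C) (f : d ⟶ c) (hf : S f) : resVec R f y = Y d f hf :=
    funext fun k => hy k d f hf
  have hmem : y ∈ 𝒜.dom i c := 𝒜.dom_local i c y S hS fun d f hf => by
    rw [hyY d f hf]
    exact hY d f hf
  refine ⟨y, hmem, ?_, ?_⟩
  · refine (hM S hS).isSeparatedFor.ext fun d f hf => ?_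
    rw [← 𝒜.ψ_res i f y hmem, hyY d f hf, hψ]
  · intro k k'
    refine (hR S hS).isSeparatedFor.ext fun d f hf => ?_
    have h1 := hn d f hf k k'
    rw [← hyY d f hf] at h1
    change (R.map f.op).hom _ = (R.map f.op).hom _
    rw [map_mul, map_sub, map_sub, map_zero]
    exact h1

variable {𝒜}

theorem exists_coord_par (hR : Presieve.IsSheaf J (R ⋙ forget (CommAlgCat.{w} ℚ)))
    (hKL : IsKL R) (hM : Presieve.IsSheaf J M) (l : AffineConnection M 𝒜.nbr) (i : 𝒜.ι) {c : C}
    {x y z : Fin (𝒜.dim i) → R.obj (op c)} (hx : x ∈ 𝒜.dom i c) (hxy : VecNbr x y)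
    (hxz : VecNbr x z) :
    ∃ w ∈ 𝒜.dom i c, 𝒜.ψ i c w = l.par c (𝒜.ψ i c x) (𝒜.ψ i c y) (𝒜.ψ i c z) ∧ VecNbr y w :=
  𝒜.exists_vecNbr_of_nbr hR hKL hM i (𝒜.dom_open i c x hx y hxy)
    (𝒜.nbr_symm _ _ _ (l.book_left _ _ _ (𝒜.nbr_of_vecNbr i hx hxy) (𝒜.nbr_of_vecNbr i hx hxz)))

/-- An affine connection on `M` in the coordinates of a chart. -/
noncomputable def coordPar (l : AffineConnection M 𝒜.nbr) (i : 𝒜.ι) (c : C)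
    (x y z : Fin (𝒜.dim i) → R.obj (op c)) : Fin (𝒜.dim i) → R.obj (op c) :=
  𝒜.coord i c (l.par c (𝒜.ψ i c x) (𝒜.ψ i c y) (𝒜.ψ i c z))

theorem coordPar_spec (hR : Presieve.IsSheaf J (R ⋙ forget (CommAlgCat.{w} ℚ)))
    (hKL : IsKL R) (hM : Presieve.IsSheaf J M) (l : AffineConnection M 𝒜.nbr) (i : 𝒜.ι) {c : C}
    {x y z : Fin (𝒜.dim i) → R.obj (op c)} (hx : x ∈ 𝒜.dom i c) (hxy : VecNbr x y)
    (hxz : VecNbr x z) :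
    coordPar l i c x y z ∈ 𝒜.dom i c ∧ 𝒜.ψ i c (coordPar l i c x y z) =
      l.par c (𝒜.ψ i c x) (𝒜.ψ i c y) (𝒜.ψ i c z) ∧ VecNbr y (coordPar l i c x y z) := by
  obtain ⟨w, hw, hψ, hn⟩ := exists_coord_par hR hKL hM l i hx hxy hxz
  rw [coordPar, 𝒜.coord_eq i hw hψ]
  exact ⟨hw, hψ, hn⟩

theorem isLocalConnection_coordPar (hR : Presieve.IsSheaf J (R ⋙ forget (CommAlgCat.{w} ℚ)))
    (hKL : IsKL R) (hM : Presieve.IsSheaf J M) (l : AffineConnection M 𝒜.nbr)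
    (hsymm : l.IsSymmetric) (hflat : l.IsFlat) (i : 𝒜.ι) :
    IsLocalConnection R (𝒜.dom i) (coordPar l i) where
  dom_res f x hx := 𝒜.dom_res i f x hx
  dom_open x hx y hxy := 𝒜.dom_open i _ x hx y hxy
  par_res {c d} f x hx y z hxy hxz := by
    obtain ⟨hw, hψ, -⟩ := coordPar_spec hR hKL hM l i hx hxy hxz
    refine (𝒜.coord_eq i (𝒜.dom_res i f _ hw) ?_).symm
    rw [𝒜.ψ_res i f _ hw, hψ, l.par_res f _ _ _ (𝒜.nbr_of_vecNbr i hx hxy)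
      (𝒜.nbr_of_vecNbr i hx hxz), 𝒜.ψ_res i f x hx,
      𝒜.ψ_res i f y (𝒜.dom_open i c x hx y hxy), 𝒜.ψ_res i f z (𝒜.dom_open i c x hx z hxz)]
  nbr_left x hx y z hxy hxz := (coordPar_spec hR hKL hM l i hx hxy hxz).2.2
  unit_left {c} x hx z hxz :=
    𝒜.coord_eq i (𝒜.dom_open i c x hx z hxz) (l.unit_left _ _ (𝒜.nbr_of_vecNbr i hx hxz)).symm
  symm {c} x hx y z hxy hxz := by
    rw [coordPar, hsymm _ _ _ _ (𝒜.nbr_of_vecNbr i hx hxy) (𝒜.nbr_of_vecNbr i hx hxz), coordPar]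
  flat {c} x hx y z hxy hyz hxz a hxa := by
    have hy := 𝒜.dom_open i c x hx y hxy
    obtain ⟨-, hψ, -⟩ := coordPar_spec hR hKL hM l i hx hxy hxa
    rw [coordPar, hψ, hflat _ _ _ _ (𝒜.nbr_of_vecNbr i hx hxy) (𝒜.nbr_of_vecNbr i hy hyz)
      (𝒜.nbr_of_vecNbr i hx hxz) _ (𝒜.nbr_of_vecNbr i hx hxa), coordPar]

/-- A path starting in a chart never leaves it, since each step goes to a neighbour. -/
theorem exists_path_coord (hR : Presieve.IsSheaf J (R ⋙ forget (CommAlgCat.{w} ℚ)))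
    (hKL : IsKL R) (hM : Presieve.IsSheaf J M) (i : 𝒜.ι) {c : C}
    {x : Fin (𝒜.dim i) → R.obj (op c)} (hx : x ∈ 𝒜.dom i c) {m : ℕ} {p : ℕ → M.obj (op c)}
    (hp : IsPath (𝒜.nbr c) m p) (h0 : 𝒜.ψ i c x = p 0) :
    ∃ y : ℕ → Fin (𝒜.dim i) → R.obj (op c), y 0 = x ∧ IsPath VecNbr m y ∧
      ∀ j ≤ m, y j ∈ 𝒜.dom i c ∧ 𝒜.ψ i c (y j) = p j := by
  have key (j : ℕ) (hj : j ≤ m) :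
      𝒜.coord i c (p j) ∈ 𝒜.dom i c ∧ 𝒜.ψ i c (𝒜.coord i c (p j)) = p j ∧
        (∀ k, j = k + 1 → VecNbr (𝒜.coord i c (p k)) (𝒜.coord i c (p j))) := by
    induction j with
    | zero =>
      rw [𝒜.coord_eq i hx h0]
      exact ⟨hx, h0, fun k hk => by omega⟩
    | succ j ih =>
      obtain ⟨h1, h2, -⟩ := ih (by omega)
      obtain ⟨y, hy, hψ, hn⟩ := 𝒜.exists_vecNbr_of_nbr hR hKL hM i h1 (m := p (j + 1)) (by
        rw [h2]
        exact hp j hj)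
      rw [𝒜.coord_eq i hy hψ]
      refine ⟨hy, hψ, fun k hk => ?_⟩
      obtain rfl : j = k := by omega
      exact hn
  exact ⟨fun j => 𝒜.coord i c (p j), 𝒜.coord_eq i hx h0,
    fun j hj => (key (j + 1) hj).2.2 j rfl, fun j hj => ⟨(key j hj).1, (key j hj).2.1⟩⟩

theorem ψ_transport (hR : Presieve.IsSheaf J (R ⋙ forget (CommAlgCat.{w} ℚ)))
    (hKL : IsKL R) (hM : Presieve.IsSheaf J M) (l : AffineConnection M 𝒜.nbr)
    (hsymm : l.IsSymmetric) (hflat : l.IsFlat) (i : 𝒜.ι) {c : C} {m : ℕ}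
    {y : ℕ → Fin (𝒜.dim i) → R.obj (op c)} {b : Fin (𝒜.dim i) → R.obj (op c)}
    (h0 : y 0 ∈ 𝒜.dom i c) (hy : IsPath VecNbr m y) (hb : VecNbr (y 0) b) :
    ∀ j ≤ m, 𝒜.ψ i c (transport (coordPar l i c) y b j) =
      transport (l.par c) (fun j => 𝒜.ψ i c (y j)) (𝒜.ψ i c b) j
  | 0, _ => rfl
  | j + 1, hj => by
    have hl := isLocalConnection_coordPar hR hKL hM l hsymm hflat i
    rw [transport, (coordPar_spec hR hKL hM l i (hl.path_mem h0 hy j (by omega)) (hy j hj)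
      (hl.transport_nbr h0 hy hb j (by omega))).2.1,
      ψ_transport hR hKL hM l hsymm hflat i h0 hy hb j (by omega), transport]

theorem ψ_grid (hR : Presieve.IsSheaf J (R ⋙ forget (CommAlgCat.{w} ℚ)))
    (hKL : IsKL R) (hM : Presieve.IsSheaf J M) (l : AffineConnection M 𝒜.nbr)
    (hsymm : l.IsSymmetric) (hflat : l.IsFlat) (i : 𝒜.ι) {c : C} {m k : ℕ}
    {y z : ℕ → Fin (𝒜.dim i) → R.obj (op c)} (h0 : y 0 ∈ 𝒜.dom i c) (hy : IsPath VecNbr m y)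
    (hz : IsPath VecNbr k z) (hyz : y 0 = z 0) {p q : ℕ → M.obj (op c)}
    (hp : ∀ j ≤ m, 𝒜.ψ i c (y j) = p j) (hq : ∀ j ≤ k, 𝒜.ψ i c (z j) = q j) :
    ∀ a ≤ k, grid (coordPar l i c) y z a 0 ∈ 𝒜.dom i c ∧
      IsPath VecNbr m (grid (coordPar l i c) y z a) ∧
      ∀ j ≤ m, 𝒜.ψ i c (grid (coordPar l i c) y z a j) = grid (l.par c) p q a j
  | 0, _ => ⟨h0, hy, hp⟩
  | a + 1, ha => by
    have hl := isLocalConnection_coordPar hR hKL hM l hsymm hflat i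
    obtain ⟨h1, h2, h3⟩ := ψ_grid hR hKL hM l hsymm hflat i h0 hy hz hyz hp hq a (by omega)
    have hn : VecNbr (grid (coordPar l i c) y z a 0) (z (a + 1)) := by
      rw [grid_zero_right _ _ _ hyz]
      exact hz a ha
    refine ⟨hl.dom_open _ h1 _ hn, hl.transport_isPath h1 h2 hn, fun j hj => ?_⟩
    rw [grid, ψ_transport hR hKL hM l hsymm hflat i h1 h2 hn j hj, hq (a + 1) ha, grid]
    exact transport_congr _ h3 _ j hj

/-- The codomain of a grid in `M` depends only on the end points of the vertical path. -/
theorem grid_eq_of_vertical (hR : Presieve.IsSheaf J (R ⋙ forget (CommAlgCat.{w} ℚ)))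
    (hKL : IsKL R) (hM : Presieve.IsSheaf J M) (l : AffineConnection M 𝒜.nbr)
    (hsymm : l.IsSymmetric) (hflat : l.IsFlat) {c : C} {m k k' : ℕ}
    {p q q' : ℕ → M.obj (op c)} (hp : IsPath (𝒜.nbr c) m p) (hq : IsPath (𝒜.nbr c) k q)
    (hq' : IsPath (𝒜.nbr c) k' q') (h0 : p 0 = q 0) (h0' : p 0 = q' 0) (hend : q k = q' k') :
    grid (l.par c) p q k m = grid (l.par c) p q' k' m := by
  -- Equality is local, and a chart around the common initial point suffices.
  obtain ⟨S, hS, hcov⟩ := 𝒜.cover c (p 0)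
  refine (hM S hS).isSeparatedFor.ext fun d f hf => ?_
  obtain ⟨i, x, hx, hψ⟩ := hcov d f hf
  have hres := @FormalAtlas.nbr_res _ _ _ _ _ 𝒜
  have hpf := IsPath.map hres f hp
  have hqf := IsPath.map hres f hq
  have hqf' := IsPath.map hres f hq'
  rw [l.map_grid 𝒜.nbr_symm hp hq h0 f k le_rfl m le_rfl,
    l.map_grid 𝒜.nbr_symm hp hq' h0' f k' le_rfl m le_rfl]
  obtain ⟨y, hy0, hy, hyψ⟩ := exists_path_coord hR hKL hM i hx hpf hψ
  obtain ⟨z, hz0, hz, hzψ⟩ := exists_path_coord hR hKL hM i hx hqf (by rw [hψ, h0])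
  obtain ⟨z', hz0', hz', hzψ'⟩ := exists_path_coord hR hKL hM i hx hqf' (by rw [hψ, h0'])
  have hy0d : y 0 ∈ 𝒜.dom i d := by rwa [hy0]
  have hl := isLocalConnection_coordPar hR hKL hM l hsymm hflat i
  rw [← (ψ_grid hR hKL hM l hsymm hflat i hy0d hy hz (by rw [hy0, hz0])
      (fun j hj => (hyψ j hj).2) (fun j hj => (hzψ j hj).2) k le_rfl).2.2 m le_rfl,
    ← (ψ_grid hR hKL hM l hsymm hflat i hy0d hy hz' (by rw [hy0, hz0'])
      (fun j hj => (hyψ j hj).2) (fun j hj => (hzψ' j hj).2) k' le_rfl).2.2 m le_rfl,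
    hl.grid_eq hKL hy0d hy hz hz' (by rw [hy0, hz0]) (by rw [hy0, hz0'])]
  refine 𝒜.ψ_inj i d (hzψ k le_rfl).1 (hzψ' k' le_rfl).1 ?_
  rw [(hzψ k le_rfl).2, (hzψ' k' le_rfl).2, hend]

/-- The codomain of a grid in `M` depends only on the end points of the two paths. -/
theorem grid_eq (hR : Presieve.IsSheaf J (R ⋙ forget (CommAlgCat.{w} ℚ)))
    (hKL : IsKL R) (hM : Presieve.IsSheaf J M) (l : AffineConnection M 𝒜.nbr)
    (hsymm : l.IsSymmetric) (hflat : l.IsFlat) {c : C} {m m' k k' : ℕ}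
    {p p' q q' : ℕ → M.obj (op c)} (hp : IsPath (𝒜.nbr c) m p) (hp' : IsPath (𝒜.nbr c) m' p')
    (hq : IsPath (𝒜.nbr c) k q) (hq' : IsPath (𝒜.nbr c) k' q') (h0 : p 0 = q 0)
    (h0' : p' 0 = q' 0) (hpp : p 0 = p' 0) (hendp : p m = p' m') (hendq : q k = q' k') :
    grid (l.par c) p q k m = grid (l.par c) p' q' k' m' := by
  -- Change the vertical path, transpose, and change the other path, which is now vertical.
  rw [grid_eq_of_vertical hR hKL hM l hsymm hflat hp hq hq' h0 (hpp.trans h0') hendq,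
    l.grid_symm 𝒜.nbr_symm hsymm hp hq' (hpp.trans h0') k' le_rfl m le_rfl,
    l.grid_symm 𝒜.nbr_symm hsymm hp' hq' h0' k' le_rfl m' le_rfl,
    grid_eq_of_vertical hR hKL hM l hsymm hflat hq' hp hp' (h0'.symm.trans hpp.symm) h0'.symm hendp]

end FormalAtlas

end Charts

/-! ### Concatenated paths and adjacent grids. -/

section Concatenation

variable {X : Type*}

/-- The concatenation of a path of length `n` with another path. -/
def concatPath (n : ℕ) (p s : ℕ → X) (j : ℕ) : X := if j ≤ n then p j else s (j - n)

theorem concatPath_of_le {n : ℕ} {p s : ℕ → X} {j : ℕ} (hj : j ≤ n) :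
    concatPath n p s j = p j := if_pos hj

theorem concatPath_add {n : ℕ} {p s : ℕ → X} (h : p n = s 0) (j : ℕ) :
    concatPath n p s (n + j) = s j := by
  rcases j with _ | j
  · rw [add_zero, concatPath_of_le le_rfl, h]
  · rw [concatPath, if_neg (by omega), Nat.add_sub_cancel_left]

theorem IsPath.concat {r : X → X → Prop} {n k : ℕ} {p s : ℕ → X} (hp : IsPath r n p)
    (hs : IsPath r k s) (h : p n = s 0) : IsPath r (n + k) (concatPath n p s) := by
  intro j hj
  rcases lt_or_ge j n with hjn | hjn
  · rw [concatPath_of_le hjn.le, concatPath_of_le hjn]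
    exact hp j hjn
  · obtain ⟨i, rfl⟩ := Nat.exists_eq_add_of_le hjn
    rw [add_assoc, concatPath_add h, concatPath_add h]
    exact hs i (by omega)

theorem grid_congr (par : X → X → X → X) {m : ℕ} {y y' : ℕ → X} (z : ℕ → X)
    (h : ∀ j ≤ m, y j = y' j) : ∀ i, ∀ j ≤ m, grid par y z i j = grid par y' z i j
  | 0 => h
  | i + 1 => transport_congr par (grid_congr par z h i) _

/-- The right edge of the grid over `p` is the vertical path of the grid over `s`. -/
theorem grid_concatPath (par : X → X → X → X) {n : ℕ} {p s q : ℕ → X} (h : p n = s 0) :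
    ∀ i j, grid par (concatPath n p s) q i (n + j) = grid par s (fun i => grid par p q i n) i j
  | 0 => concatPath_add h
  | i + 1 => fun j => by
    induction j with
    | zero =>
      rw [grid_zero_right par _ _ h.symm, add_zero]
      exact grid_congr par q (fun j hj => concatPath_of_le hj) _ n le_rfl
    | succ j ih =>
      rw [← add_assoc, grid_succ_succ, grid_succ_succ, ih, grid_concatPath par h i j, add_assoc,
        grid_concatPath par h i (j + 1)]

end Concatenation

/-! ### Gluing grid values into a global connection. -/

section GridExtension

variable {C : Type u} [Category.{v} C] {J : GrothendieckTopology C} {M : Cᵒᵖ ⥤ Type t}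
  {r : StageRel M}

/-- `w` is the codomain of a grid spanned by some path from `x` to `y` and some path from `x`
to `z`. -/
def IsGridValue (l : AffineConnection M r) (c : C) (x y z w : M.obj (op c)) : Prop :=
  ∃ (n m : ℕ) (p q : ℕ → M.obj (op c)), IsPath (r c) n p ∧ IsPath (r c) m q ∧ p 0 = x ∧ q 0 = x ∧
    p n = y ∧ q m = z ∧ grid (l.par c) p q m n = w

namespace AffineConnection

variable {l : AffineConnection M r}

theorem isGridExtension_iff {L : AffineConnection M (totalRel M)} :
    l.IsGridExtension L ↔
      ∀ (c : C) (x y z w : M.obj (op c)), IsGridValue l c x y z w → L.par c x y z = w := by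
  constructor
  · rintro h c x y z w ⟨n, m, p, q, hp, hq, rfl, hpq, rfl, rfl, rfl⟩
    exact h c n m p q hp hq hpq.symm
  · exact fun h c n m p q hp hq hpq =>
      h c _ _ _ _ ⟨n, m, p, q, hp, hq, rfl, hpq.symm, rfl, rfl, rfl⟩

theorem isGridValue_par {c : C} {x y z : M.obj (op c)} (hy : r c x y) (hz : r c x z) :
    IsGridValue l c x y z (l.par c x y z) :=
  ⟨1, 1, fun j => if j = 0 then x else y, fun j => if j = 0 then x else z,
    fun j hj => by obtain rfl : j = 0 := by omega
                   simpa using hy,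
    fun j hj => by obtain rfl : j = 0 := by omega
                   simpa using hz, rfl, rfl, rfl, rfl, rfl⟩

variable (hr : ∀ (c : C) (x y : M.obj (op c)), r c x y → r c y x)
  (hres : ∀ {c d : C} (f : d ⟶ c) (x y : M.obj (op c)), r c x y →
    r d (M.map f.op x) (M.map f.op y))
  (hind : ∀ (c : C) (x y z w w' : M.obj (op c)), IsGridValue l c x y z w →
    IsGridValue l c x y z w' → w = w')
  (hM : Presieve.IsSheaf J M) (hconn : PathConnected J M r)

include hr hres in
theorem isGridValue_map {c d : C} (f : d ⟶ c) {x y z w : M.obj (op c)}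
    (h : IsGridValue l c x y z w) :
    IsGridValue l d (M.map f.op x) (M.map f.op y) (M.map f.op z) (M.map f.op w) := by
  obtain ⟨n, m, p, q, hp, hq, hpx, hqx, rfl, rfl, rfl⟩ := h
  exact ⟨n, m, _, _, hp.map hres f, hq.map hres f, by rw [hpx], by rw [hqx], rfl, rfl,
    (l.map_grid hr hp hq (hpx.trans hqx.symm) f m le_rfl n le_rfl).symm⟩

include hconn in
theorem exists_isGridValue {c : C} (x y z : M.obj (op c)) :
    ∃ S ∈ J c, ∀ (d : C) (f : d ⟶ c), S f →
      ∃ w, IsGridValue l d (M.map f.op x) (M.map f.op y) (M.map f.op z) w := by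
  obtain ⟨S, hS, h⟩ := hconn c x y
  obtain ⟨S', hS', h'⟩ := hconn c x z
  refine ⟨S ⊓ S', J.intersection_covering hS hS', fun d f hf => ?_⟩
  obtain ⟨n, p, hp, hp0, hpn⟩ := h d f hf.1
  obtain ⟨m, q, hq, hq0, hqm⟩ := h' d f hf.2
  exact ⟨_, n, m, p, q, hp, hq, hp0, hq0, hpn, hqm, rfl⟩

-- Grid values exist on a cover and are unique by `hind`, so they glue. A value at an arbitrary
-- later stage is compared with the glued one on the pulled back cover.
include hr hres hind hM hconn in
theorem exists_glued_gridValue {c : C} (x y z : M.obj (op c)) :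
    ∃ w : M.obj (op c), ∀ (d : C) (f : d ⟶ c) (w' : M.obj (op d)),
      IsGridValue l d (M.map f.op x) (M.map f.op y) (M.map f.op z) w' → M.map f.op w = w' := by
  obtain ⟨S, hS, h⟩ := exists_isGridValue (l := l) hconn x y z
  choose W hW using h
  obtain ⟨w, hw, -⟩ := hM S hS (fun d f hf => W d f hf)
    ((Presieve.compatible_iff_sieveCompatible _).2 (by
      intro d e f g hf
      have h1 := isGridValue_map hr hres g (hW d f hf)
      have h2 := hW e (g ≫ f) (S.downward_closed hf g)
      simp only [op_comp, Functor.map_comp_apply] at h2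
      exact hind _ _ _ _ _ _ h2 h1))
  refine ⟨w, fun d f w' hw' => ?_⟩
  refine (hM (S.pullback f) (J.pullback_stable f hS)).isSeparatedFor.ext fun e g hg => ?_
  have h1 := isGridValue_map hr hres g hw'
  have h2 := hW e (g ≫ f) hg
  simp only [op_comp, Functor.map_comp_apply] at h2
  have h3 := hw (g ≫ f) hg
  rw [op_comp, Functor.map_comp_apply] at h3
  rw [h3]
  exact hind _ _ _ _ _ _ h2 h1

variable {Λ : ∀ c : C, M.obj (op c) → M.obj (op c) → M.obj (op c) → M.obj (op c)}
  (hΛ : ∀ {c d : C} (f : d ⟶ c) (x y z : M.obj (op c)),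
    M.map f.op (Λ c x y z) = Λ d (M.map f.op x) (M.map f.op y) (M.map f.op z))
  (hval : ∀ (c : C) (x y z w : M.obj (op c)), IsGridValue l c x y z w → Λ c x y z = w)

include hM hconn hΛ hval in
theorem eq_of_gridValues
    {Λ' : ∀ c : C, M.obj (op c) → M.obj (op c) → M.obj (op c) → M.obj (op c)}
    (hΛ' : ∀ {c d : C} (f : d ⟶ c) (x y z : M.obj (op c)),
      M.map f.op (Λ' c x y z) = Λ' d (M.map f.op x) (M.map f.op y) (M.map f.op z))
    (hval' : ∀ (c : C) (x y z w : M.obj (op c)), IsGridValue l c x y z w → Λ' c x y z = w)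
    (c : C) (x y z : M.obj (op c)) : Λ c x y z = Λ' c x y z := by
  obtain ⟨S, hS, h⟩ := exists_isGridValue (l := l) hconn x y z
  refine (hM S hS).isSeparatedFor.ext fun d f hf => ?_
  obtain ⟨w, hw⟩ := h d f hf
  rw [hΛ, hΛ', hval _ _ _ _ _ hw, hval' _ _ _ _ _ hw]

include hM hconn hΛ hval in
theorem gridValues_left {c : C} (x z : M.obj (op c)) : Λ c x x z = z := by
  obtain ⟨S, hS, h⟩ := hconn c x z
  refine (hM S hS).isSeparatedFor.ext fun d f hf => ?_
  obtain ⟨m, q, hq, hq0, hqm⟩ := h d f hf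
  rw [hΛ]
  -- With a constant path of length `0` the grid degenerates to the vertical path.
  exact hval _ _ _ _ _ ⟨0, m, fun _ => M.map f.op x, q, fun j hj => by omega, hq, rfl, hq0, rfl,
    hqm, (grid_zero_right _ _ _ hq0.symm m).trans hqm⟩

include hM hconn hΛ hval in
theorem gridValues_right {c : C} (x y : M.obj (op c)) : Λ c x y x = y := by
  obtain ⟨S, hS, h⟩ := hconn c x y
  refine (hM S hS).isSeparatedFor.ext fun d f hf => ?_
  obtain ⟨n, p, hp, hp0, hpn⟩ := h d f hf
  rw [hΛ]
  exact hval _ _ _ _ _ ⟨n, 0, p, fun _ => M.map f.op x, hp, fun j hj => by omega, hp0, rfl, hpn,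
    rfl, hpn⟩

-- Concatenate a path from `x` to `a` with one from `a` to `b`: the right edge of the first grid
-- joins `a` to `[z x a]` and spans the second grid.
include hr hM hconn hΛ hval in
theorem gridValues_comp {c : C} (x a b z : M.obj (op c)) :
    Λ c a b (Λ c x a z) = Λ c x b z := by
  obtain ⟨S₁, hS₁, h₁⟩ := hconn c x a
  obtain ⟨S₂, hS₂, h₂⟩ := hconn c a b
  obtain ⟨S₃, hS₃, h₃⟩ := hconn c x z
  refine (hM (S₁ ⊓ S₂ ⊓ S₃) (J.intersection_covering (J.intersection_covering hS₁ hS₂)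
    hS₃)).isSeparatedFor.ext fun d f hf => ?_
  obtain ⟨n, p, hp, hp0, hpn⟩ := h₁ d f hf.1.1
  obtain ⟨k, s, hs, hs0, hsk⟩ := h₂ d f hf.1.2
  obtain ⟨m, q, hq, hq0, hqm⟩ := h₃ d f hf.2
  rw [hΛ, hΛ, hΛ]
  have hps : p n = s 0 := hpn.trans hs0.symm
  have hpq : p 0 = q 0 := hp0.trans hq0.symm
  rw [hval _ _ _ _ _ ⟨n, m, p, q, hp, hq, hp0, hq0, hpn, hqm, rfl⟩,
    hval _ _ _ _ _ ⟨k, m, s, fun i => grid (l.par d) p q i n, hs,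
      fun i hi => l.grid_rel_succ hr hp hq hpq hi le_rfl, hs0, hpn, hsk, rfl, rfl⟩,
    hval _ (M.map f.op x) _ _ _ ⟨n + k, m, concatPath n p s, q, hp.concat hs hps, hq,
      (concatPath_of_le (Nat.zero_le n)).trans hp0, hq0, (concatPath_add hps k).trans hsk, hqm,
      rfl⟩, grid_concatPath _ hps]

include hr hM hconn hΛ hval in
theorem gridValues_symm (hl : l.IsSymmetric) {c : C} (x y z : M.obj (op c)) :
    Λ c x y z = Λ c x z y := by
  obtain ⟨S, hS, h⟩ := exists_isGridValue (l := l) hconn x y z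
  refine (hM S hS).isSeparatedFor.ext fun d f hf => ?_
  obtain ⟨w, hw⟩ := h d f hf
  rw [hΛ, hΛ, hval _ _ _ _ _ hw]
  obtain ⟨n, m, p, q, hp, hq, hpx, hqx, hpn, hqm, rfl⟩ := hw
  exact (hval _ _ _ _ _ ⟨m, n, q, p, hq, hp, hqx, hpx, hqm, hpn,
    l.grid_symm hr hl hq hp (hqx.trans hpx.symm) n le_rfl m le_rfl⟩).symm

include hr hres hind hM hconn in
theorem exists_isGridExtension : ∃ L : AffineConnection M (totalRel M), l.IsGridExtension L := by
  choose Λ h using fun c x y z =>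
    exists_glued_gridValue (l := l) hr hres hind hM hconn (c := c) x y z
  have hval (c : C) (x y z w : M.obj (op c)) (hw : IsGridValue l c x y z w) : Λ c x y z = w := by
    have := h c x y z c (𝟙 c) w (by simpa using hw)
    simpa using this
  have hΛ {c d : C} (f : d ⟶ c) (x y z : M.obj (op c)) :
      M.map f.op (Λ c x y z) = Λ d (M.map f.op x) (M.map f.op y) (M.map f.op z) := by
    obtain ⟨S, hS, hloc⟩ := exists_isGridValue (l := l) hconn (M.map f.op x) (M.map f.op y)
      (M.map f.op z)
    refine (hM S hS).isSeparatedFor.ext fun e g hg => ?_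
    obtain ⟨w, hw⟩ := hloc e g hg
    rw [h d _ _ _ e g w hw, ← Functor.map_comp_apply, ← op_comp]
    exact h c x y z e (g ≫ f) w (by simpa only [op_comp, Functor.map_comp_apply] using hw)
  refine ⟨⟨Λ, fun f x y z _ _ => hΛ f x y z, fun _ _ _ _ _ => trivial, fun _ _ _ _ _ => trivial,
    fun x z _ => gridValues_left hM hconn hΛ hval x z,
    fun x y _ => gridValues_right hM hconn hΛ hval x y, fun x y z _ _ => ?_⟩,
    isGridExtension_iff.2 hval⟩
  -- Inversion: `[[z x y] y x] = [z x x] = z`.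
  rw [gridValues_comp hr hM hconn hΛ hval, gridValues_left hM hconn hΛ hval]

end AffineConnection

end GridExtension

end Kock

theorem mainTheorem10 {C : Type u} [Category.{v} C] (J : GrothendieckTopology C)
    (R : Cᵒᵖ ⥤ CommAlgCat.{w} ℚ) (hR : Presieve.IsSheaf J (R ⋙ forget (CommAlgCat.{w} ℚ)))
    (hKL : Kock.IsKL R)
    (M : Cᵒᵖ ⥤ Type t) (hM : Presieve.IsSheaf J M) (𝒜 : Kock.FormalAtlas.{v, u, w, t, s} J R M)
    (hconn : Kock.PathConnected J M 𝒜.nbr)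
    (l : Kock.AffineConnection M 𝒜.nbr) (hsymm : l.IsSymmetric) (hflat : l.IsFlat) :
    (∃! L : Kock.AffineConnection M (Kock.totalRel M), l.IsGridExtension L) ∧
      ∀ L : Kock.AffineConnection M (Kock.totalRel M), l.IsGridExtension L →
        (∀ (c : C) (x y z : M.obj (op c)), 𝒜.nbr c x y → 𝒜.nbr c x z →
          L.par c x y z = l.par c x y z) ∧
        L.IsSymmetric ∧ L.IsFlatOnParallelograms := by
  have hr := 𝒜.nbr_symm
  have hind : ∀ (c : C) (x y z w w' : M.obj (op c)), Kock.IsGridValue l c x y z w →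
      Kock.IsGridValue l c x y z w' → w = w' := by
    rintro c x y z w w' ⟨n, m, p, q, hp, hq, hpx, hqx, hpn, hqm, rfl⟩
      ⟨n', m', p', q', hp', hq', hpx', hqx', hpn', hqm', rfl⟩
    exact Kock.FormalAtlas.grid_eq hR hKL hM l hsymm hflat hp hp' hq hq' (hpx.trans hqx.symm)
      (hpx'.trans hqx'.symm) (hpx.trans hpx'.symm) (hpn.trans hpn'.symm) (hqm.trans hqm'.symm)
  have hnat (L : Kock.AffineConnection M (Kock.totalRel M)) {c d : C} (f : d ⟶ c)
      (x y z : M.obj (op c)) :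
      M.map f.op (L.par c x y z) = L.par d (M.map f.op x) (M.map f.op y) (M.map f.op z) :=
    L.par_res f x y z trivial trivial
  constructor
  · obtain ⟨L, hL⟩ :=
      Kock.AffineConnection.exists_isGridExtension hr 𝒜.nbr_res hind hM hconn
    refine ⟨L, hL, fun L' hL' => ?_⟩
    ext c x y z
    exact Kock.AffineConnection.eq_of_gridValues hM hconn (hnat L')
      (Kock.AffineConnection.isGridExtension_iff.1 hL') (hnat L)
      (Kock.AffineConnection.isGridExtension_iff.1 hL) c x y z
  · intro L hL
    rw [Kock.AffineConnection.isGridExtension_iff] at hL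
    have hsymmL : L.IsSymmetric := fun c x y z _ _ =>
      Kock.AffineConnection.gridValues_symm hr hM hconn (hnat L) hL hsymm x y z
    refine ⟨fun c x y z hy hz => hL _ _ _ _ _ (Kock.AffineConnection.isGridValue_par hy hz),
      hsymmL, fun c x a b z _ _ _ => ?_⟩
    -- The two sides collapse to the transport of `z` from `x` to `[a x b]` and to `[b x a]`, which
    -- agree by symmetry.
    rw [Kock.AffineConnection.gridValues_comp hr hM hconn (hnat L) hL,
      Kock.AffineConnection.gridValues_comp hr hM hconn (hnat L) hL,
      hsymmL c x b a trivial trivial]
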